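/- Write $\mathbb R_+=(0,\infty)$. For $\alpha:\mathbb R_+\to\mathbb C$, $N\ge 0$ and tuples $\kappa_1\in\mathbb C^{k_1}$, $\lambda_1\in\mathbb C^{l_1}$, $\kappa_2\in\mathbb C^{k_2}$, $\lambda_2\in\mathbb C^{l_2}$, the $\kappa$'s having entries outside $[0,\infty)$, let $$Z^{(N)}_{k_1|l_1;k_2|l_2}(\kappa_1,\lambda_1;\kappa_2,\lambda_2)=\frac1{(N!)^2}\int_{\mathbb R_+^{2N}}\frac{\Delta_N^2(x)\Delta_N^2(y)}{\prod_{i,j=1}^N(x_i+y_j)}\prod_{j=1}^N\left(\alpha(x_j)\alpha(y_j)\,y_j\,\frac{\prod_{i=1}^{l_1}(x_j-\lambda_{1,i})\prod_{i=1}^{l_2}(y_j-\lambda_{2,i})}{\prod_{i=1}^{k_1}(x_j-\kappa_{1,i})\prod_{i=1}^{k_2}(y_j-\kappa_{2,i})}\right)dx\,dy$$ be the partition function of the Cauchy-like two-matrix model with weight $\alpha$, where $\Delta_n(u)=\prod_{1\le i<j\le n}(u_j-u_i)$. Write $Z^{(N)}=Z^{(N)}_{0|0;0|0}$ and $$B_{k|l}(\kappa;\lambda)=\frac{\Delta_k(\kappa)\Delta_l(\lambda)}{\prod_{i=1}^k\prod_{j=1}^l(\kappa_i-\lambda_j)}.$$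 Define the kernels $$\widehat K_{11}^{(L)}(\kappa_1,\kappa_2)=\frac{Z^{(L)}_{1|0;1|0}(\kappa_1;\kappa_2)-Z^{(L)}_{1|0;1|0}(\kappa_2;\kappa_1)}{2Z^{(L-1)}},\qquad \widehat K_{01}^{(L)}(\kappa,\lambda)=\frac{Z^{(L)}_{0|0;1|1}(\kappa,\lambda)+Z^{(L)}_{1|1;0|0}(\kappa,\lambda)}{2Z^{(L)}(\kappa-\lambda)},$$ $$\widehat K_{00}^{(L)}(\lambda_1,\lambda_2)=\frac{Z^{(L)}_{0|1;0|1}(\lambda_2;\lambda_1)-Z^{(L)}_{0|1;0|1}(\lambda_1;\lambda_2)}{2Z^{(L+1)}},$$ $$\widehat K_{1}^{(L)}(\kappa)=\frac{Z^{(L)}_{0|0;1|0}(\kappa)+Z^{(L)}_{1|0;0|0}(\kappa)}{2Z^{(L)}},\qquad \widehat K_{0}^{(L)}(\lambda)=\frac{Z^{(L)}_{0|0;0|1}(\lambda)-Z^{(L)}_{0|1;0|0}(\lambda)}{2Z^{(L+1)}}.$$ **Proposition.** Let $N,k,l\ge 0$ be integers with $N+l-k>1$, let $\kappa_1,\dots,\kappa_k\in\mathbb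 C\setminus[0,\infty)$ and $\lambda_1,\dots,\lambda_l\in\mathbb C$ be pairwise different. Put $L=N+l-k$ if $k+l$ is even and $L=N+l-k+1$ if $k+l$ is odd, and let $\alpha$ be such that $x\mapsto x^n\alpha(x)$ is integrable on $\mathbb R_+$ for $0\le n<L$ and $Z^{(L)}\ne0$. If $k+l$ is even, then $$Z^{(N)}_{k|l;k|l}(\kappa,\lambda;\kappa,\lambda)=\frac{Z^{(L)}}{B_{k|l}^2(\kappa;\lambda)}\det\begin{bmatrix}\widehat K_{11}^{(L+1)}(\kappa_i,\kappa_j)&-\widehat K_{01}^{(L)}(\kappa_i,\lambda_j)\\ \widehat K_{01}^{(L)}(\kappa_j,\lambda_i)&\widehat K_{00}^{(L-1)}(\lambda_i,\lambda_j)\end{bmatrix}.$$ If $k+l$ is odd, then $$Z^{(N)}_{k|l;k|l}(\kappa,\lambda;\kappa,\lambda)=\frac{Z^{(L)}}{B_{k|l}^2(\kappa;\lambda)}\det\begin{bmatrix}\widehat K_{11}^{(L+1)}(\kappa_i,\kappa_j)&-\widehat K_{01}^{(L)}(\kappa_i,\lambda_j)&-\widehat K_1^{(L)}(\kappa_i)\\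 \widehat K_{01}^{(L)}(\kappa_j,\lambda_i)&\widehat K_{00}^{(L-1)}(\lambda_i,\lambda_j)&\widehat K_0^{(L-1)}(\lambda_i)\\ \widehat K_1^{(L)}(\kappa_j)&-\widehat K_0^{(L-1)}(\lambda_j)&0\end{bmatrix}.$$ In both formulas $1\le i,j\le k$ in the first block of rows and columns and $1\le i,j\le l$ in the second one. -/

import Mathlib

open MeasureTheory

/-- The Vandermonde product `Δ_n(u) = ∏_{i < j} (u_j - u_i)`. -/
def vandermondeProd {R : Type*} [CommRing R] {n : ℕ} (u : Fin n → R) : R :=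
  ∏ i, ∏ j ∈ Finset.Ioi i, (u j - u i)

/-- The mixed Cauchy-Vandermonde product
`B_{k|l}(κ; λ) = Δ_k(κ) Δ_l(λ) / ∏_{i,j} (κ_i - λ_j)`. -/
noncomputable def mixedCauchyVandermonde {k l : ℕ} (kap : Fin k → ℂ) (lam : Fin l → ℂ) : ℂ :=
  vandermondeProd kap * vandermondeProd lam / ∏ i, ∏ j, (kap i - lam j)

/-- Lebesgue measure on `ℝ₊^N`, where `ℝ₊ = (0, ∞)`. -/
noncomputable def positiveLebesgue (N : ℕ) : Measure (Fin N → ℝ) :=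
  Measure.pi fun _ => volume.restrict (Set.Ioi 0)

/-- The one-variable factor `∏_i (x - λ_i) / ∏_i (x - κ_i)`. -/
noncomputable def charRatio {k l : ℕ} (kap : Fin k → ℂ) (lam : Fin l → ℂ) (x : ℝ) : ℂ :=
  (∏ i, ((x : ℂ) - lam i)) / ∏ i, ((x : ℂ) - kap i)

/-- The partition function `Z^{(N,C)}_{k₁|l₁;k₂|l₂}[α](κ₁, λ₁; κ₂, λ₂)` of the Cauchy-like
two-matrix model with one-point weight `α`. -/
noncomputable def cauchyPartition (α : ℝ → ℂ) (N : ℕ) {k₁ l₁ k₂ l₂ : ℕ}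
    (kap₁ : Fin k₁ → ℂ) (lam₁ : Fin l₁ → ℂ) (kap₂ : Fin k₂ → ℂ) (lam₂ : Fin l₂ → ℂ) : ℂ :=
  1 / ((N.factorial : ℂ) ^ 2) *
    ∫ p : (Fin N → ℝ) × (Fin N → ℝ),
      ((vandermondeProd p.1 ^ 2 * vandermondeProd p.2 ^ 2 /
          ∏ i, ∏ j, (p.1 i + p.2 j) : ℝ) : ℂ) *
        ∏ j, (α (p.1 j) * α (p.2 j) * (p.2 j : ℂ) *
          (charRatio kap₁ lam₁ (p.1 j) * charRatio kap₂ lam₂ (p.2 j)))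
      ∂((positiveLebesgue N).prod (positiveLebesgue N))

/-- The normalization `Z^{(N,C)}_{0|0;0|0}[α]`. -/
noncomputable def cauchyNormalization (α : ℝ → ℂ) (N : ℕ) : ℂ :=
  cauchyPartition α N ![] ![] ![] ![]

/-- The kernel `K̂₁₁^{(L)}(κ₁, κ₂)`. -/
noncomputable def kernel11 (α : ℝ → ℂ) (L : ℕ) (kap₁ kap₂ : ℂ) : ℂ :=
  (cauchyPartition α L ![kap₁] ![] ![kap₂] ![] - cauchyPartition α L ![kap₂] ![] ![kap₁] ![]) /
    (2 * cauchyNormalization α (L - 1))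

/-- The kernel `K̂₀₁^{(L)}(κ, λ)`. -/
noncomputable def kernel01 (α : ℝ → ℂ) (L : ℕ) (kap lam : ℂ) : ℂ :=
  (cauchyPartition α L ![] ![] ![kap] ![lam] + cauchyPartition α L ![kap] ![lam] ![] ![]) /
    (2 * cauchyNormalization α L * (kap - lam))

/-- The kernel `K̂₀₀^{(L)}(λ₁, λ₂)`. -/
noncomputable def kernel00 (α : ℝ → ℂ) (L : ℕ) (lam₁ lam₂ : ℂ) : ℂ :=
  (cauchyPartition α L ![] ![lam₂] ![] ![lam₁] - cauchyPartition α L ![] ![lam₁] ![] ![lam₂]) /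
    (2 * cauchyNormalization α (L + 1))

/-- The kernel `K̂₁^{(L)}(κ)`. -/
noncomputable def kernel1 (α : ℝ → ℂ) (L : ℕ) (kap : ℂ) : ℂ :=
  (cauchyPartition α L ![] ![] ![kap] ![] + cauchyPartition α L ![kap] ![] ![] ![]) /
    (2 * cauchyNormalization α L)

/-- The kernel `K̂₀^{(L)}(λ)`. -/
noncomputable def kernel0 (α : ℝ → ℂ) (L : ℕ) (lam : ℂ) : ℂ :=
  (cauchyPartition α L ![] ![] ![] ![lam] - cauchyPartition α L ![] ![lam] ![] ![]) /
    (2 * cauchyNormalization α (L + 1))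

/-- The antisymmetric matrix with blocks
`[K̂₁₁^{(L+1)}(κ_i, κ_j), -K̂₀₁^{(L)}(κ_i, λ_j); K̂₀₁^{(L)}(κ_j, λ_i), K̂₀₀^{(L-1)}(λ_i, λ_j)]`. -/
noncomputable def kernelMatrixEven (α : ℝ → ℂ) (L : ℕ) {k l : ℕ}
    (kap : Fin k → ℂ) (lam : Fin l → ℂ) : Matrix (Fin k ⊕ Fin l) (Fin k ⊕ Fin l) ℂ :=
  Matrix.fromBlocks
    (Matrix.of fun i j => kernel11 α (L + 1) (kap i) (kap j))
    (Matrix.of fun i j => -kernel01 α L (kap i) (lam j))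
    (Matrix.of fun i j => kernel01 α L (kap j) (lam i))
    (Matrix.of fun i j => kernel00 α (L - 1) (lam i) (lam j))

/-- The antisymmetric matrix `kernelMatrixEven` bordered by the last column
`(-K̂₁^{(L)}(κ_i), K̂₀^{(L-1)}(λ_i), 0)` and the last row
`(K̂₁^{(L)}(κ_j), -K̂₀^{(L-1)}(λ_j), 0)`. -/
noncomputable def kernelMatrixOdd (α : ℝ → ℂ) (L : ℕ) {k l : ℕ}
    (kap : Fin k → ℂ) (lam : Fin l → ℂ) :
    Matrix ((Fin k ⊕ Fin l) ⊕ Unit) ((Fin k ⊕ Fin l) ⊕ Unit) ℂ :=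
  Matrix.fromBlocks
    (kernelMatrixEven α L kap lam)
    (Matrix.of fun i _ =>
      Sum.elim (fun a => -kernel1 α L (kap a)) (fun b => kernel0 α (L - 1) (lam b)) i)
    (Matrix.of fun _ j =>
      Sum.elim (fun a => kernel1 α L (kap a)) (fun b => -kernel0 α (L - 1) (lam b)) j)
    0

/-! The Cauchy determinant and Andréief's identity turn every partition function into a Gram
determinant of one bilinear form on polynomials (`cauchyPartition_eq_gramDet`), namely integration
of p(x)q(y)/(Q(x)Q(y)) against α(x)α(y) y/(x+y), with Q = ∏(X - κ_i). Since y/(x+y) + x/(x+y) = 1,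
the symmetric part of this form has rank one.

With P = ∏(X - λ_j), the left side is the Gram determinant of P, PX, …, PX^(N-1), and Z^(L) is that
of Q, QX, …, QX^(L-1). The form is extended by coordinate vectors that pair antisymmetrically with
functionals: evaluation at each λ_j and, when k+l is odd, the top coefficient as well. The Gram
determinant of the polynomials of degree < k+L together with these vectors is computed in two bases
(`gramDet_mul_eq_det_borderDet`). The functionals vanish on every P X^a, so the basis P X^a with
complementary monomials gives the left side times a squared determinant. The basis Q X^a with the
Lagrange numerators Q/(X - κ_i) gives Δ(κ)^2 times the same value; the factors combine to B^2.

In the second basis a Schur complement splits off Z^(L). The complement has even size, and its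
symmetric part again has rank one, so antisymmetrizing it leaves its determinant unchanged
(`det_fromBlocks_of_add_transpose_eq_vecMulVec`). Its entries are quotients of bordered Gram
determinants. A basis in which a functional vanishes on all but one vector reduces these to
partition functions with at most one κ and one λ per matrix, which yields the kernels. -/

/-! ### Vandermonde, Lagrange and Cauchy determinants -/

section NodalDeterminants

open Polynomial

variable {K : Type*} [Field K] {n : ℕ}

theorem vandermondeProd_eq_det {R : Type*} [CommRing R] (u : Fin n → R) :
    vandermondeProd u = (Matrix.vandermonde u).det :=
  (Matrix.det_vandermonde u).symm

theorem vandermondeProd_ne_zero {u : Fin n → K} (hu : Function.Injective u) :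
    vandermondeProd u ≠ 0 := by
  rw [vandermondeProd_eq_det]
  exact Matrix.det_vandermonde_ne_zero_iff.2 hu

theorem vandermondeProd_neg_sq (u : Fin n → K) :
    vandermondeProd (fun i => -u i) ^ 2 = vandermondeProd u ^ 2 := by
  simp only [vandermondeProd, ← Finset.prod_pow]
  refine Finset.prod_congr rfl fun i _ => Finset.prod_congr rfl fun j _ => ?_
  ring

/-- The factors with j < i form Δ(u) and those with j > i form Δ(-u). Keeping Δ(-u) avoids an
explicit sign. -/
theorem prod_prod_erase_sub (u : Fin n → K) :
    ∏ i, ∏ j ∈ Finset.univ.erase i, (u i - u j) =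
      vandermondeProd u * vandermondeProd (fun i => -u i) := by
  have split : ∀ i : Fin n, ∏ j ∈ Finset.univ.erase i, (u i - u j) =
      (∏ j ∈ Finset.Iio i, (u i - u j)) * ∏ j ∈ Finset.Ioi i, (u i - u j) := by
    intro i
    rw [← Finset.prod_union]
    · refine Finset.prod_congr ?_ fun _ _ => rfl
      ext j
      simp only [Finset.mem_erase, Finset.mem_univ, and_true, Finset.mem_union, Finset.mem_Iio,
        Finset.mem_Ioi]
      exact lt_or_lt_iff_ne.symm
    · rw [Finset.disjoint_left]
      intro j hj hj'
      exact lt_asymm (Finset.mem_Iio.1 hj) (Finset.mem_Ioi.1 hj')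
  rw [Finset.prod_congr rfl fun i _ => split i, Finset.prod_mul_distrib]
  congr 1
  · unfold vandermondeProd
    refine Finset.prod_comm' fun i j => ?_
    simp
  · unfold vandermondeProd
    refine Finset.prod_congr rfl fun i _ => Finset.prod_congr rfl fun j _ => ?_
    ring

/-- The numerator `∏_{j ≠ i} (X - u_j)` of the Lagrange basis polynomial. -/
noncomputable def lagrangeNumerator (u : Fin n → K) (i : Fin n) : K[X] :=
  ∏ j ∈ Finset.univ.erase i, (X - C (u j))

theorem lagrangeNumerator_monic (u : Fin n → K) (i : Fin n) : (lagrangeNumerator u i).Monic :=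
  monic_prod_of_monic _ _ fun j _ => monic_X_sub_C (u j)

theorem natDegree_lagrangeNumerator (u : Fin n → K) (i : Fin n) :
    (lagrangeNumerator u i).natDegree = n - 1 := by
  rw [lagrangeNumerator, natDegree_prod_of_monic _ _ fun j _ => monic_X_sub_C (u j)]
  simp

theorem natDegree_lagrangeNumerator_lt (u : Fin n → K) (i : Fin n) :
    (lagrangeNumerator u i).natDegree < n := by
  have := i.pos
  rw [natDegree_lagrangeNumerator]
  omega

theorem lagrangeNumerator_mul (u : Fin n → K) (i : Fin n) :
    lagrangeNumerator u i * (X - C (u i)) = ∏ j, (X - C (u j)) := by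
  rw [lagrangeNumerator, Finset.prod_erase_mul _ _ (Finset.mem_univ i)]

theorem eval_lagrangeNumerator (u : Fin n → K) (i : Fin n) (x : K) :
    (lagrangeNumerator u i).eval x = ∏ j ∈ Finset.univ.erase i, (x - u j) := by
  simp [lagrangeNumerator, eval_prod]

theorem eval_eq_sum_fin {R : Type*} [CommSemiring R] {p : R[X]} {m : ℕ} (hp : p.natDegree < m)
    (x : R) : p.eval x = ∑ b : Fin m, p.coeff b * x ^ (b : ℕ) := by
  rw [eval_eq_sum_range' hp, Finset.sum_range]

/-- Multiplying by the transposed Vandermonde matrix evaluates the numerators at the nodes, where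
they are diagonal; Δ(u) then cancels. -/
theorem det_coeff_lagrangeNumerator {u : Fin n → K} (hu : Function.Injective u) :
    (Matrix.of fun i b : Fin n => (lagrangeNumerator u i).coeff b).det =
      vandermondeProd fun i => -u i := by
  refine mul_right_cancel₀ (vandermondeProd_ne_zero hu) ?_
  rw [mul_comm (vandermondeProd _) (vandermondeProd u), ← prod_prod_erase_sub,
    vandermondeProd_eq_det, ← Matrix.det_transpose (Matrix.vandermonde u), ← Matrix.det_mul,
    ← Matrix.det_diagonal]
  congr 1
  ext i m
  rw [Matrix.mul_apply]
  simp only [Matrix.of_apply, Matrix.transpose_apply, Matrix.vandermonde_apply]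
  rw [← eval_eq_sum_fin (natDegree_lagrangeNumerator_lt u i), eval_lagrangeNumerator]
  rcases eq_or_ne i m with rfl | h
  · simp
  · rw [Matrix.diagonal_apply_ne _ h]
    exact Finset.prod_eq_zero (Finset.mem_erase.2 ⟨h.symm, Finset.mem_univ m⟩) (sub_self _)

/-- The **Cauchy determinant**. -/
theorem det_cauchy (x y : Fin n → K) (h : ∀ i j, x i + y j ≠ 0) :
    (Matrix.of fun i j => (x i + y j)⁻¹).det =
      vandermondeProd x * vandermondeProd y / ∏ i, ∏ j, (x i + y j) := by
  have hne : ∏ i, ∏ j, (x i + y j) ≠ 0 :=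
    Finset.prod_ne_zero_iff.2 fun i _ => Finset.prod_ne_zero_iff.2 fun j _ => h i j
  rw [eq_div_iff hne]
  by_cases hx : Function.Injective x
  -- Scaling column j by ∏_m (x_m + y_j) turns entry (i, j) into the i-th Lagrange numerator for the
  -- nodes -x, evaluated at y_j. The scaled matrix is thus a coefficient matrix times a transposed
  -- Vandermonde matrix.
  · set u : Fin n → K := fun i => -x i with hu
    have hu_inj : Function.Injective u := fun i j hij => hx (neg_injective hij)
    have key := det_coeff_lagrangeNumerator hu_inj
    rw [show (fun i => -u i) = x by ext; simp [hu]] at key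
    rw [← key, vandermondeProd_eq_det y, ← Matrix.det_transpose (Matrix.vandermonde y),
      ← Matrix.det_mul, Finset.prod_comm, mul_comm, ← Matrix.det_mul_row]
    congr 1
    ext i j
    rw [Matrix.mul_apply]
    simp only [Matrix.of_apply, Matrix.transpose_apply, Matrix.vandermonde_apply]
    rw [← eval_eq_sum_fin (natDegree_lagrangeNumerator_lt u i), eval_lagrangeNumerator,
      ← Finset.mul_prod_erase _ _ (Finset.mem_univ i), mul_comm, inv_mul_cancel_left₀ (h i j)]
    exact Finset.prod_congr rfl fun m _ => by simp [hu, add_comm]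
  · have hv : vandermondeProd x = 0 := by
      rw [vandermondeProd_eq_det, Matrix.det_vandermonde_eq_zero_iff]
      obtain ⟨i, j, hij, hne'⟩ := Function.not_injective_iff.1 hx
      exact ⟨i, j, hij, hne'⟩
    obtain ⟨i, j, hij, hne'⟩ := Function.not_injective_iff.1 hx
    rw [hv, zero_mul, Matrix.det_zero_of_row_eq hne' (by ext m; simp [hij]), zero_mul]

end NodalDeterminants

/-! ### Rank-one perturbations of antisymmetric matrices -/

section AntisymmetricDeterminants

open Matrix

variable {ι τ : Type*} [Fintype ι] [DecidableEq ι] [Fintype τ] [DecidableEq τ]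

theorem det_eq_zero_of_antisymm {A : Matrix ι ι ℂ} (hA : Aᵀ = -A) (hodd : Odd (Fintype.card ι)) :
    A.det = 0 := by
  have h := congrArg Matrix.det hA
  rw [det_transpose, det_neg, hodd.neg_one_pow, neg_one_mul] at h
  exact self_eq_neg.1 h

/-- The correction is c vᵀ adj(A) v, and the adjugate of an antisymmetric matrix of even order is
antisymmetric. The proof splits the last row (-c v, 1) of a bordered matrix as c(-v, 0) + (0, 1):
the first part gives an antisymmetric matrix of odd order, the second gives det A. -/
theorem det_add_smul_vecMulVec_of_antisymm {A : Matrix ι ι ℂ} (hA : Aᵀ = -A)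
    (heven : Even (Fintype.card ι)) (v : ι → ℂ) (c : ℂ) :
    (A + c • vecMulVec v v).det = A.det := by
  let M : (ι ⊕ Unit → ℂ) → Matrix (ι ⊕ Unit) (ι ⊕ Unit) ℂ := fun r =>
    updateRow (fromBlocks A (of fun i _ => v i) 0 0) (Sum.inr ()) r
  have hM : ∀ (t : ι → ℂ) (s : ℂ), M (Sum.elim t fun _ => s) =
      fromBlocks A (of fun i _ => v i) (of fun _ j => t j) (of fun _ _ => s) := by
    intro t s
    ext i j
    rcases i with i | i <;> rcases j with j | j <;> simp [M, updateRow_apply]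
  have hsplit : (Sum.elim (fun j => -c * v j) fun _ => (1 : ℂ) : ι ⊕ Unit → ℂ) =
      c • Sum.elim (fun j => -v j) (fun _ => (0 : ℂ)) + Sum.elim (fun _ => (0 : ℂ)) fun _ => 1 := by
    ext j
    rcases j with j | j <;> simp
  have h1 : (M (Sum.elim (fun j => -c * v j) fun _ => (1 : ℂ))).det =
      (A + c • vecMulVec v v).det := by
    rw [hM, show (of fun _ _ => (1 : ℂ) : Matrix Unit Unit ℂ) = 1 by ext; simp,
      det_fromBlocks_one₂₂]
    congr 1
    ext i j
    simp [mul_apply, vecMulVec_apply]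
    ring
  have h2 : (M (Sum.elim (fun _ => (0 : ℂ)) fun _ => 1)).det = A.det := by
    rw [hM, show (of fun _ _ => (0 : ℂ) : Matrix Unit ι ℂ) = 0 by ext; simp,
      det_fromBlocks_zero₂₁]
    simp
  have h3 : (M (Sum.elim (fun j => -v j) fun _ => (0 : ℂ))).det = 0 := by
    rw [hM]
    refine det_eq_zero_of_antisymm ?_ ?_
    · ext i j
      rcases i with i | i <;> rcases j with j | j
      · simpa using congrFun (congrFun hA i) j
      all_goals simp
    · simpa using heven.add_one
  rw [← h1, hsplit]
  simp only [M, det_updateRow_add, det_updateRow_smul] at h2 h3 ⊢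
  rw [h2, h3, mul_zero, zero_add]

/-- If the symmetric part of a matrix has rank one, the same holds for its Schur complements, and
a Schur complement of even size may be replaced by its antisymmetric part. -/
theorem det_fromBlocks_of_add_transpose_eq_vecMulVec {P : Matrix ι ι ℂ} {B : Matrix ι τ ℂ}
    {C : Matrix τ ι ℂ} {D : Matrix τ τ ℂ} {p : ι → ℂ} {q : τ → ℂ}
    (hP : P + Pᵀ = vecMulVec p p) (hB : B + Cᵀ = vecMulVec p q) (hD : D + Dᵀ = vecMulVec q q)
    (hdet : P.det ≠ 0) (heven : Even (Fintype.card τ)) :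
    (fromBlocks P B C D).det =
      P.det * (of fun s t => ((D - C * P⁻¹ * B) s t - (D - C * P⁻¹ * B) t s) / 2).det := by
  have hunit : IsUnit P.det := isUnit_iff_ne_zero.2 hdet
  let := P.invertibleOfIsUnitDet hunit
  rw [det_fromBlocks₁₁, invOf_eq_nonsing_inv]
  congr 1
  set Y : Matrix τ ι ℂ := C * P⁻¹ with hY
  have hYP : Y * P = C := by rw [hY, Matrix.mul_assoc, nonsing_inv_mul _ hunit, Matrix.mul_one]
  set S : Matrix τ τ ℂ := D - Y * B with hS
  set v : τ → ℂ := q - Y *ᵥ p with hv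
  have hC : C + Bᵀ = vecMulVec q p := by
    have := congrArg transpose hB
    rw [transpose_add, transpose_transpose, transpose_vecMulVec] at this
    rw [← this, add_comm]
  -- With Y P = C, the Schur complement S is [-Y 1] M [-Y 1]ᵀ for the whole block matrix M, so the
  -- vector (p, q) of its symmetric part becomes q - Y p.
  have hsym : S + Sᵀ = vecMulVec v v := by
    have e1 : vecMulVec v v = vecMulVec q q - Y * vecMulVec p q - vecMulVec q p * Yᵀ
        + Y * vecMulVec p p * Yᵀ := by
      rw [hv, Matrix.mul_vecMulVec, Matrix.mul_vecMulVec, vecMulVec_mul, vecMulVec_mul,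
        vecMul_transpose, sub_vecMulVec, vecMulVec_sub, vecMulVec_sub]
      abel
    have e2 : Y * Pᵀ * Yᵀ = Y * Cᵀ := by
      rw [Matrix.mul_assoc, ← transpose_mul, hYP]
    rw [e1, ← hP, ← hB, ← hD, ← hC, Matrix.mul_add, Matrix.mul_add, Matrix.add_mul,
      Matrix.add_mul, e2, hYP, hS, transpose_sub, transpose_mul]
    abel
  set A : Matrix τ τ ℂ := of fun s t => (S s t - S t s) / 2 with hA
  have hanti : Aᵀ = -A := by
    ext s t
    simp only [hA, transpose_apply, Matrix.neg_apply, of_apply]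
    ring
  have hdecomp : S = A + (1 / 2 : ℂ) • vecMulVec v v := by
    rw [← hsym]
    ext s t
    simp only [hA, of_apply, Matrix.add_apply, Matrix.smul_apply, transpose_apply, smul_eq_mul]
    ring
  rw [hdecomp, det_add_smul_vecMulVec_of_antisymm hanti heven]

end AntisymmetricDeterminants

/-! ### Gram determinants and their Schur complements -/

section Gram

open Matrix

variable {W : Type*} [AddCommGroup W] [Module ℂ W]

/-- The Gram matrix of two families of vectors with respect to a bilinear form. -/
def gramMatrix {ι κ : Type*} (β : W →ₗ[ℂ] W →ₗ[ℂ] ℂ) (f : ι → W) (g : κ → W) : Matrix ι κ ℂ :=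
  Matrix.of fun i j => β (f i) (g j)

theorem gramMatrix_apply {ι κ : Type*} (β : W →ₗ[ℂ] W →ₗ[ℂ] ℂ) (f : ι → W) (g : κ → W)
    (i : ι) (j : κ) : gramMatrix β f g i j = β (f i) (g j) := rfl

theorem gramMatrix_sum_elim {ι κ : Type*} (β : W →ₗ[ℂ] W →ₗ[ℂ] ℂ) (f : ι → W) (g : κ → W) :
    gramMatrix β (Sum.elim f g) (Sum.elim f g) =
      fromBlocks (gramMatrix β f f) (gramMatrix β f g) (gramMatrix β g f) (gramMatrix β g g) := by
  ext i j
  rcases i with i | i <;> rcases j with j | j <;> rfl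

/-- This reads an entry of a Schur complement as a quotient of Gram determinants of sizes L + 1 and
L. -/
theorem det_gramMatrix_cons {L : ℕ} (β : W →ₗ[ℂ] W →ₗ[ℂ] ℂ) (f : Fin L → W) (x y : W)
    (hdet : (gramMatrix β f f).det ≠ 0) :
    (gramMatrix β (Fin.cons x f : Fin (L + 1) → W) (Fin.cons y f : Fin (L + 1) → W)).det =
      (gramMatrix β f f).det *
        (β x y - ∑ b, (∑ a, β x (f a) * (gramMatrix β f f)⁻¹ a b) * β (f b) y) := by
  have hunit : IsUnit (gramMatrix β f f).det := isUnit_iff_ne_zero.2 hdet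
  let := (gramMatrix β f f).invertibleOfIsUnitDet hunit
  -- The added vector moves from first to last place in rows and columns alike, so no sign appears.
  let e : Fin (L + 1) ≃ Fin L ⊕ Unit :=
    (finSuccEquiv L).trans (Equiv.optionEquivSumPUnit (Fin L))
  have hM : gramMatrix β (Fin.cons x f : Fin (L + 1) → W) (Fin.cons y f : Fin (L + 1) → W) =
      (fromBlocks (gramMatrix β f f) (of fun a (_ : Unit) => β (f a) y)
        (of fun (_ : Unit) b => β x (f b)) (of fun _ _ => β x y)).submatrix e e := by
    ext i j
    refine Fin.cases ?_ (fun i => ?_) i <;> refine Fin.cases ?_ (fun j => ?_) j <;>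
      simp [e, gramMatrix]
  rw [hM, det_submatrix_equiv_self, det_fromBlocks₁₁, invOf_eq_nonsing_inv]
  congr 1
  simp [Matrix.mul_apply]

theorem det_gramMatrix_sum_elim {L : ℕ} {τ : Type*} [Fintype τ] [DecidableEq τ]
    (β : W →ₗ[ℂ] W →ₗ[ℂ] ℂ) (w : W → ℂ) (hβ : ∀ x y, β x y + β y x = w x * w y)
    (f : Fin L → W) (g : τ → W) (hdet : (gramMatrix β f f).det ≠ 0)
    (heven : Even (Fintype.card τ)) :
    (gramMatrix β (Sum.elim f g) (Sum.elim f g)).det =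
      (gramMatrix β f f).det *
        (of fun s t =>
          ((gramMatrix β (Fin.cons (g s) f : Fin (L + 1) → W) (Fin.cons (g t) f)).det -
            (gramMatrix β (Fin.cons (g t) f : Fin (L + 1) → W) (Fin.cons (g s) f)).det) /
            (2 * (gramMatrix β f f).det)).det := by
  rw [gramMatrix_sum_elim, det_fromBlocks_of_add_transpose_eq_vecMulVec
    (p := fun a => w (f a)) (q := fun s => w (g s)) _ _ _ hdet heven]
  · congr 2
    ext s t
    rw [of_apply, of_apply, det_gramMatrix_cons β f _ _ hdet, det_gramMatrix_cons β f _ _ hdet]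
    simp only [Matrix.sub_apply, Matrix.mul_apply, gramMatrix_apply]
    field_simp
  all_goals
    ext i j
    simp [gramMatrix, vecMulVec_apply, hβ]

theorem gramMatrix_eq_mul {ι κ ι' κ' : Type*} [Fintype ι'] [Fintype κ'] (β : W →ₗ[ℂ] W →ₗ[ℂ] ℂ)
    {f : ι → W} {f' : ι' → W} {g : κ → W} {g' : κ' → W} (R : Matrix ι ι' ℂ) (T : Matrix κ κ' ℂ)
    (hf : ∀ i, f i = ∑ a, R i a • f' a) (hg : ∀ j, g j = ∑ b, T j b • g' b) :
    gramMatrix β f g = R * gramMatrix β f' g' * Tᵀ := by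
  ext i j
  simp only [gramMatrix_apply, hf, hg, Matrix.mul_apply, transpose_apply, map_sum, map_smul,
    LinearMap.sum_apply, LinearMap.smul_apply, smul_eq_mul, Finset.mul_sum, Finset.sum_mul]
  refine Finset.sum_congr rfl fun b _ => Finset.sum_congr rfl fun a _ => ?_
  ring

end Gram

/-! ### Bordering a form by functionals, and the change of basis -/

section BorderedForm

open Matrix Polynomial

variable {J : Type*} [Fintype J] [DecidableEq J]

/-- The determinant of the Gram matrix of `p * X ^ a` against `q * X ^ b` for `a, b < m`. -/
noncomputable def gramDet (β : ℂ[X] →ₗ[ℂ] ℂ[X] →ₗ[ℂ] ℂ) (p q : ℂ[X]) (m : ℕ) : ℂ :=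
  (gramMatrix β (fun a : Fin m => p * X ^ (a : ℕ)) fun b : Fin m => q * X ^ (b : ℕ)).det

theorem gramDet_flip (β : ℂ[X] →ₗ[ℂ] ℂ[X] →ₗ[ℂ] ℂ) (p q : ℂ[X]) (m : ℕ) :
    gramDet β.flip p q m = gramDet β q p m := by
  rw [gramDet, gramDet, ← det_transpose]
  rfl

/-- The extension of a bilinear form by an antisymmetric pairing with a family of functionals. -/
noncomputable def borderedForm (β : ℂ[X] →ₗ[ℂ] ℂ[X] →ₗ[ℂ] ℂ) (φ : J → ℂ[X] →ₗ[ℂ] ℂ) :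
    ℂ[X] × (J → ℂ) →ₗ[ℂ] ℂ[X] × (J → ℂ) →ₗ[ℂ] ℂ :=
  LinearMap.mk₂ ℂ (fun x y => β x.1 y.1 + ∑ j, y.2 j * φ j x.1 - ∑ j, x.2 j * φ j y.1)
    (fun x x' y => by
      simp only [Prod.fst_add, Prod.snd_add, map_add, LinearMap.add_apply, Pi.add_apply, add_mul,
        mul_add, Finset.sum_add_distrib]
      ring)
    (fun c x y => by
      simp only [Prod.smul_fst, Prod.smul_snd, map_smul, LinearMap.smul_apply, Pi.smul_apply,
        smul_eq_mul, mul_sub, mul_add, Finset.mul_sum]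
      refine congrArg₂ _ (congrArg₂ _ rfl ?_) ?_ <;>
        exact Finset.sum_congr rfl fun _ _ => by ring)
    (fun x y y' => by
      simp only [Prod.fst_add, Prod.snd_add, map_add, Pi.add_apply, add_mul,
        mul_add, Finset.sum_add_distrib]
      ring)
    (fun c x y => by
      simp only [Prod.smul_fst, Prod.smul_snd, map_smul, Pi.smul_apply,
        smul_eq_mul, mul_sub, mul_add, Finset.mul_sum]
      refine congrArg₂ _ (congrArg₂ _ rfl ?_) ?_ <;>
        exact Finset.sum_congr rfl fun _ _ => by ring)

/-- The coordinate vector that represents the functional with index `j` in a bordered form. -/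
noncomputable def functionalVector (j : J) : ℂ[X] × (J → ℂ) := (0, Pi.single j 1)

omit [DecidableEq J] in
theorem borderedForm_inl_inl (β : ℂ[X] →ₗ[ℂ] ℂ[X] →ₗ[ℂ] ℂ) (φ : J → ℂ[X] →ₗ[ℂ] ℂ) (p q : ℂ[X]) :
    borderedForm β φ (p, 0) (q, 0) = β p q := by
  simp [borderedForm]

theorem borderedForm_inl_functional (β : ℂ[X] →ₗ[ℂ] ℂ[X] →ₗ[ℂ] ℂ) (φ : J → ℂ[X] →ₗ[ℂ] ℂ)
    (p : ℂ[X]) (j : J) : borderedForm β φ (p, 0) (functionalVector j) = φ j p := by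
  simp [borderedForm, functionalVector, Pi.single_apply]

theorem borderedForm_functional_inl (β : ℂ[X] →ₗ[ℂ] ℂ[X] →ₗ[ℂ] ℂ) (φ : J → ℂ[X] →ₗ[ℂ] ℂ)
    (p : ℂ[X]) (j : J) : borderedForm β φ (functionalVector j) (p, 0) = -φ j p := by
  simp [borderedForm, functionalVector, Pi.single_apply]

theorem borderedForm_functional_functional (β : ℂ[X] →ₗ[ℂ] ℂ[X] →ₗ[ℂ] ℂ)
    (φ : J → ℂ[X] →ₗ[ℂ] ℂ) (i j : J) :
    borderedForm β φ (functionalVector i) (functionalVector j) = 0 := by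
  simp [borderedForm, functionalVector]

omit [DecidableEq J] in
theorem borderedForm_add_swap {β : ℂ[X] →ₗ[ℂ] ℂ[X] →ₗ[ℂ] ℂ} {w : ℂ[X] → ℂ}
    (hβ : ∀ p q, β p q + β q p = w p * w q) (φ : J → ℂ[X] →ₗ[ℂ] ℂ) (x y : ℂ[X] × (J → ℂ)) :
    borderedForm β φ x y + borderedForm β φ y x = w x.1 * w y.1 := by
  simp only [borderedForm, LinearMap.mk₂_apply, ← hβ]
  ring

theorem det_gramMatrix_base_change {W ι ι' : Type*} [AddCommGroup W] [Module ℂ W] [Fintype ι]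
    [DecidableEq ι] [Fintype ι'] [DecidableEq ι'] (β : W →ₗ[ℂ] W →ₗ[ℂ] ℂ) (e : ι ≃ ι')
    {f : ι → W} {g : ι' → W} (R : Matrix ι ι' ℂ) (h : ∀ i, f i = ∑ a, R i a • g a) :
    (gramMatrix β f f).det = (R.submatrix id e).det ^ 2 * (gramMatrix β g g).det := by
  have h' : ∀ i, f i = ∑ a, (R.submatrix id e) i a • g (e a) := by
    intro i
    rw [h i, ← e.sum_comp]
    rfl
  rw [gramMatrix_eq_mul β _ _ h' h', det_mul, det_mul, det_transpose,
    ← det_submatrix_equiv_self e (gramMatrix β g g)]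
  rw [show (gramMatrix β g g).submatrix e e = gramMatrix β (fun a => g (e a)) fun a => g (e a)
    from rfl]
  ring

theorem eq_sum_coeff_smul {p : ℂ[X]} {n : ℕ} (hp : p.natDegree < n) :
    p = ∑ a : Fin n, p.coeff a • (X : ℂ[X]) ^ (a : ℕ) := by
  conv_lhs => rw [p.as_sum_range' n hp, Finset.sum_range]
  simp [smul_X_eq_monomial]

theorem det_coeff_monic {σ : Type*} [Fintype σ] [DecidableEq σ] {n : ℕ} (e : σ ≃ Fin n)
    {u : σ → ℂ[X]} (hu : ∀ s, (u s).Monic) (hdeg : ∀ s, (u s).natDegree = e s) :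
    (of fun s t : σ => (u s).coeff (e t)).det = 1 := by
  have := det_matrixOfPolynomials (fun a => u (e.symm a)) (fun a => by simp [hdeg])
    fun a => hu _
  rw [← det_transpose, ← det_submatrix_equiv_self e] at this
  rw [← this]
  congr 1
  ext s t
  simp

/-- Monic families with degrees 0, …, n - 1 differ by unitriangular matrices, so all of them give
the same determinant. This links the two bases. -/
theorem det_gramMatrix_monic {W σ : Type*} [AddCommGroup W] [Module ℂ W] [Fintype σ]
    [DecidableEq σ] (β : W →ₗ[ℂ] W →ₗ[ℂ] ℂ) (incl : ℂ[X] →ₗ[ℂ] W) {n : ℕ} (e : σ ≃ Fin n)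
    {u : σ → ℂ[X]} (hu : ∀ s, (u s).Monic) (hdeg : ∀ s, (u s).natDegree = e s) (δ : J → W) :
    (gramMatrix β (Sum.elim (fun s => incl (u s)) δ) (Sum.elim (fun s => incl (u s)) δ)).det =
      (gramMatrix β (Sum.elim (fun a : Fin n => incl (X ^ (a : ℕ))) δ)
        (Sum.elim (fun a : Fin n => incl (X ^ (a : ℕ))) δ)).det := by
  rw [det_gramMatrix_base_change β (e.sumCongr (Equiv.refl J))
    (g := Sum.elim (fun a : Fin n => incl (X ^ (a : ℕ))) δ)
    (fromBlocks (of fun s (a : Fin n) => (u s).coeff a) 0 0 1)]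
  · rw [show (fromBlocks (of fun s (a : Fin n) => (u s).coeff a) 0 0 (1 : Matrix J J ℂ)).submatrix
        id (e.sumCongr (Equiv.refl J)) = fromBlocks (of fun s t : σ => (u s).coeff (e t)) 0 0 1 by
      ext i j
      rcases i with i | i <;> rcases j with j | j <;> simp]
    rw [det_fromBlocks_zero₂₁, det_coeff_monic e hu hdeg]
    simp
  · rintro (s | j)
    · simp only [Sum.elim_inl, Fintype.sum_sum_type, fromBlocks_apply₁₁, fromBlocks_apply₁₂,
        of_apply, Matrix.zero_apply, zero_smul, Finset.sum_const_zero, add_zero, Sum.elim_inr]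
      conv_lhs => rw [eq_sum_coeff_smul (p := u s) (n := n) (by rw [hdeg]; exact (e s).2)]
      simp [map_sum, map_smul]
    · simp [Fintype.sum_sum_type, Matrix.one_apply]

/-- On the functional vectors only the pairings with c survive, which decouples the Gram matrix of p
from β(p, c) and β(c, c). -/
theorem det_gramMatrix_functional {ν : Type*} [Fintype ν] [DecidableEq ν]
    (β : ℂ[X] →ₗ[ℂ] ℂ[X] →ₗ[ℂ] ℂ) (φ : J → ℂ[X] →ₗ[ℂ] ℂ) (p : ν → ℂ[X]) (c : J → ℂ[X])
    (hp : ∀ j a, φ j (p a) = 0) :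
    (gramMatrix (borderedForm β φ)
      (Sum.elim (fun s => LinearMap.inl ℂ ℂ[X] (J → ℂ) (Sum.elim p c s)) functionalVector)
      (Sum.elim (fun s => LinearMap.inl ℂ ℂ[X] (J → ℂ) (Sum.elim p c s)) functionalVector)).det =
      (gramMatrix β p p).det * (of fun i j => φ j (c i)).det ^ 2 := by
  set T : Matrix J J ℂ := of fun i j => φ j (c i) with hT
  -- The symplectic matrix swaps the columns of c with those of the functionals, up to signs and
  -- with determinant one. The result is block triangular with diagonal blocks Gram(p), T and Tᵀ.
  let R : Matrix (ν ⊕ (J ⊕ J)) (ν ⊕ (J ⊕ J)) ℂ := fromBlocks 1 0 0 (Matrix.J J ℂ)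
  have hR : R.det = 1 := by
    rw [det_fromBlocks_zero₂₁, det_one, one_mul, SymplecticGroup.det_eq_one (SymplecticGroup.J_mem J ℂ)]
  let a := Equiv.sumAssoc ν J J
  set M := gramMatrix (borderedForm β φ)
      (Sum.elim (fun s => LinearMap.inl ℂ ℂ[X] (J → ℂ) (Sum.elim p c s)) functionalVector)
      (Sum.elim (fun s => LinearMap.inl ℂ ℂ[X] (J → ℂ) (Sum.elim p c s)) functionalVector) with hM
  have hblocks : M.submatrix a.symm a.symm = fromBlocks (gramMatrix β p p)
      (of fun i => Sum.elim (fun j => β (p i) (c j)) fun _ => 0)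
      (of (Sum.elim (fun i j => β (c i) (p j)) fun _ _ => 0))
      (fromBlocks (gramMatrix β c c) T (-Tᵀ) 0) := by
    ext i j
    rcases i with i | i | i <;> rcases j with j | j | j <;>
      simp [a, M, gramMatrix, borderedForm_inl_inl, borderedForm_inl_functional,
        borderedForm_functional_inl, borderedForm_functional_functional, hp, T]
  have hprod : (M.submatrix a.symm a.symm * R).submatrix a a =
      fromBlocks (fromBlocks (gramMatrix β p p) 0 (gramMatrix β c p) T)
        (of (Sum.elim (fun i j => -β (p i) (c j)) fun i j => -β (c i) (c j))) 0 Tᵀ := by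
    rw [hblocks, fromBlocks_multiply, Matrix.J, fromBlocks_multiply]
    ext i j
    rcases i with (i | i) | i <;> rcases j with (j | j) | j <;>
      simp [a, Matrix.mul_apply, gramMatrix, Fintype.sum_sum_type, Matrix.one_apply]
  calc M.det = (M.submatrix a.symm a.symm * R).det := by
        rw [det_mul, hR, mul_one, det_submatrix_equiv_self]
    _ = ((M.submatrix a.symm a.symm * R).submatrix a a).det :=
        (det_submatrix_equiv_self _ _).symm
    _ = (gramMatrix β p p).det * T.det ^ 2 := by
        rw [hprod, det_fromBlocks_zero₂₁, det_fromBlocks_zero₁₂, det_transpose]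
        ring

/-- All Lagrange numerators have degree k - 1, so exchanging them for 1, …, X^(k-1) is not
unitriangular; it costs the square of the determinant of their coefficients. -/
theorem det_gramMatrix_lagrangeNumerator {W ι : Type*} [AddCommGroup W] [Module ℂ W] [Fintype ι]
    [DecidableEq ι] (β : W →ₗ[ℂ] W →ₗ[ℂ] ℂ) (incl : ℂ[X] →ₗ[ℂ] W) {k : ℕ} {kap : Fin k → ℂ}
    (hkap : Function.Injective kap) (f : ι → W) (δ : J → W) :
    (gramMatrix β (Sum.elim f (Sum.elim (fun i => incl (lagrangeNumerator kap i)) δ))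
      (Sum.elim f (Sum.elim (fun i => incl (lagrangeNumerator kap i)) δ))).det =
    vandermondeProd kap ^ 2 *
      (gramMatrix β (Sum.elim f (Sum.elim (fun b : Fin k => incl (X ^ (b : ℕ))) δ))
        (Sum.elim f (Sum.elim (fun b : Fin k => incl (X ^ (b : ℕ))) δ))).det := by
  rw [det_gramMatrix_base_change β (Equiv.refl _)
    (g := Sum.elim f (Sum.elim (fun b : Fin k => incl (X ^ (b : ℕ))) δ))
    (fromBlocks 1 0 0 (fromBlocks
      (of fun i b : Fin k => (lagrangeNumerator kap i).coeff b) 0 0 1))]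
  · rw [Equiv.coe_refl, submatrix_id_id, det_fromBlocks_zero₂₁, det_fromBlocks_zero₂₁,
      det_coeff_lagrangeNumerator hkap, det_one, det_one, one_mul, mul_one,
      vandermondeProd_neg_sq]
  · rintro (a | i | j)
    · simp [Fintype.sum_sum_type, Matrix.one_apply]
    · conv_lhs =>
        rw [Sum.elim_inr, Sum.elim_inl,
          eq_sum_coeff_smul (natDegree_lagrangeNumerator_lt kap i)]
      simp [Fintype.sum_sum_type]
    · simp [Fintype.sum_sum_type, Matrix.one_apply]

/-- The vectors added to `Q, Q X, …`: the Lagrange numerators and the functionals. -/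
noncomputable def borderVector {k : ℕ} (kap : Fin k → ℂ) : Fin k ⊕ J → ℂ[X] × (J → ℂ) :=
  Sum.elim (fun i => (lagrangeNumerator kap i, 0)) functionalVector

/-- The Gram determinant of `Q, Q X, …` with additional row vector `x` and column vector `y`. -/
noncomputable def borderDet (β : ℂ[X] →ₗ[ℂ] ℂ[X] →ₗ[ℂ] ℂ) (φ : J → ℂ[X] →ₗ[ℂ] ℂ) (Q : ℂ[X])
    (L : ℕ) (x y : ℂ[X] × (J → ℂ)) : ℂ :=
  (gramMatrix (borderedForm β φ)
    (Fin.cons x fun a : Fin L => (Q * X ^ (a : ℕ), 0) : Fin (L + 1) → ℂ[X] × (J → ℂ))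
    (Fin.cons y fun a : Fin L => (Q * X ^ (a : ℕ), 0))).det

/-- Both sides equal Δ(κ)^2 times one Gram determinant, that of 1, …, X^(n-1) and the functional
vectors. The left side uses P X^a and c, the right side Q X^a, the Lagrange numerators and a Schur
complement. The bijection e records that the degrees of P X^a and c exhaust 0, …, n - 1. -/
theorem gramDet_mul_eq_det_borderDet {β : ℂ[X] →ₗ[ℂ] ℂ[X] →ₗ[ℂ] ℂ} {w : ℂ[X] → ℂ}
    (hβ : ∀ p q, β p q + β q p = w p * w q) (φ : J → ℂ[X] →ₗ[ℂ] ℂ) {N k L n : ℕ}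
    {kap : Fin k → ℂ} (hkap : Function.Injective kap) (hn : k + L = n)
    {P : ℂ[X]} (hP : P.Monic) {c : J → ℂ[X]} (hc : ∀ j, (c j).Monic) (e : Fin N ⊕ J ≃ Fin n)
    (heP : ∀ a : Fin N, P.natDegree + a = e (Sum.inl a))
    (hec : ∀ j, (c j).natDegree = e (Sum.inr j))
    (hφ : ∀ j (a : Fin N), φ j (P * X ^ (a : ℕ)) = 0)
    (hdet : gramDet β (∏ i, (X - C (kap i))) (∏ i, (X - C (kap i))) L ≠ 0)
    (heven : Even (k + Fintype.card J)) :
    gramDet β P P N * (of fun i j => φ j (c i)).det ^ 2 * vandermondeProd kap ^ 2 =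
      gramDet β (∏ i, (X - C (kap i))) (∏ i, (X - C (kap i))) L *
        (of fun s t =>
          (borderDet β φ (∏ i, (X - C (kap i))) L (borderVector kap s) (borderVector kap t) -
            borderDet β φ (∏ i, (X - C (kap i))) L (borderVector kap t) (borderVector kap s)) /
          (2 * gramDet β (∏ i, (X - C (kap i))) (∏ i, (X - C (kap i))) L)).det := by
  set Q : ℂ[X] := ∏ i, (X - C (kap i)) with hQ
  have hQm : Q.Monic := monic_prod_of_monic _ _ fun j _ => monic_X_sub_C (kap j)
  have hQd : Q.natDegree = k := by
    rw [hQ, natDegree_prod_of_monic _ _ fun j _ => monic_X_sub_C (kap j)]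
    simp
  let incl := LinearMap.inl ℂ ℂ[X] (J → ℂ)
  let f : Fin L → ℂ[X] × (J → ℂ) := fun a => (Q * X ^ (a : ℕ), 0)
  have hff : gramMatrix (borderedForm β φ) f f =
      gramMatrix β (fun a : Fin L => Q * X ^ (a : ℕ)) fun a : Fin L => Q * X ^ (a : ℕ) := by
    ext i j
    simp [gramMatrix, f, borderedForm_inl_inl]
  have h1 := det_gramMatrix_sum_elim (borderedForm β φ) (fun x => w x.1)
    (borderedForm_add_swap hβ φ) f (borderVector (J := J) kap) (by rwa [hff])
    (by simpa using heven)
  rw [hff] at h1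
  refine Eq.trans ?_ h1
  have h2 := det_gramMatrix_lagrangeNumerator (borderedForm β φ) incl hkap f
    (functionalVector : J → _)
  rw [show (Sum.elim (fun i => incl (lagrangeNumerator kap i)) functionalVector :
    Fin k ⊕ J → ℂ[X] × (J → ℂ)) = borderVector kap from rfl] at h2
  rw [h2]
  let u : Fin L ⊕ Fin k → ℂ[X] :=
    Sum.elim (fun a : Fin L => Q * X ^ (a : ℕ)) fun b : Fin k => X ^ (b : ℕ)
  let e₁ : Fin L ⊕ Fin k ≃ Fin n :=
    ((Equiv.sumComm _ _).trans finSumFinEquiv).trans (finCongr hn)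
  have h3 := det_gramMatrix_monic (borderedForm β φ) incl e₁ (u := u)
    (by rintro (a | b)
        · exact hQm.mul (monic_X_pow _)
        · exact monic_X_pow _)
    (by rintro (a | b)
        · simp only [u, Sum.elim_inl, hQm.natDegree_mul (monic_X_pow _), hQd, natDegree_X_pow]
          simp [e₁]
        · simp [u, e₁])
    (functionalVector : J → _)
  have h4 := det_gramMatrix_monic (borderedForm β φ) incl e
    (u := Sum.elim (fun a : Fin N => P * X ^ (a : ℕ)) c)
    (by rintro (a | j)
        · exact hP.mul (monic_X_pow _)
        · exact hc j)
    (by rintro (a | j)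
        · simp only [Sum.elim_inl, hP.natDegree_mul (monic_X_pow _), natDegree_X_pow, heP]
        · exact hec j)
    (functionalVector : J → _)
  have h5 := det_gramMatrix_functional β φ (fun a : Fin N => P * X ^ (a : ℕ)) c
    (fun j a => hφ j a)
  have h6 : (gramMatrix (borderedForm β φ)
      (Sum.elim f (Sum.elim (fun b : Fin k => incl (X ^ (b : ℕ))) functionalVector))
      (Sum.elim f (Sum.elim (fun b : Fin k => incl (X ^ (b : ℕ))) functionalVector))).det =
      (gramMatrix (borderedForm β φ)
        (Sum.elim (fun s => incl (u s)) (functionalVector : J → _))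
        (Sum.elim (fun s => incl (u s)) functionalVector)).det := by
    rw [← det_submatrix_equiv_self (Equiv.sumAssoc (Fin L) (Fin k) J)]
    congr 1
    ext i j
    rcases i with (i | i) | i <;> rcases j with (j | j) | j <;> rfl
  rw [h6, h3, ← h4, h5, gramDet]
  ring

end BorderedForm

/-! ### Evaluation of the bordered determinants -/

section BorderDeterminants

open Matrix Polynomial

theorem det_functional_monic {m : ℕ} (ℓ : Fin m → ℂ[X] →ₗ[ℂ] ℂ) (p : ℂ[X]) {u : Fin m → ℂ[X]}
    (hu : ∀ a, (u a).Monic) (hdeg : ∀ a, (u a).natDegree = a) :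
    (of fun a b => ℓ b (p * u a)).det = (of fun a b : Fin m => ℓ b (p * X ^ (a : ℕ))).det := by
  have h : (of fun a b => ℓ b (p * u a)) =
      (of fun a c : Fin m => (u a).coeff c) * of fun a b : Fin m => ℓ b (p * X ^ (a : ℕ)) := by
    ext a b
    rw [Matrix.mul_apply, of_apply]
    conv_lhs => rw [eq_sum_coeff_smul (p := u a) (n := m) (by rw [hdeg]; exact a.2)]
    simp [Finset.mul_sum, map_sum, map_smul]
  have hone := det_coeff_monic (Equiv.refl (Fin m)) hu hdeg
  rw [Equiv.coe_refl] at hone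
  rw [h, det_mul]
  exact (congrArg (· * _) hone).trans (one_mul _)

theorem det_cons_functional_monic {m : ℕ} (r : Fin (m + 1) → ℂ)
    (ℓ : Fin (m + 1) → ℂ[X] →ₗ[ℂ] ℂ) (p : ℂ[X]) {u : Fin m → ℂ[X]}
    (hu : ∀ a, (u a).Monic) (hdeg : ∀ a, (u a).natDegree = a) :
    (of (Fin.cons r fun a b => ℓ b (p * u a) : Fin (m + 1) → Fin (m + 1) → ℂ)).det =
      (of (Fin.cons r fun a b => ℓ b (p * X ^ (a : ℕ)) :
        Fin (m + 1) → Fin (m + 1) → ℂ)).det := by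
  rw [det_succ_row_zero, det_succ_row_zero]
  refine Finset.sum_congr rfl fun j _ => congrArg₂ _ (by simp) ?_
  exact det_functional_monic (fun b => ℓ (j.succAbove b)) p hu hdeg

/-- As Q = q (X - c), the factor q leaves the monic family 1, X - c, (X - c)X, … of degrees 0, …, L,
which may then be replaced by any other such family. -/
theorem cons_mul_X_pow_eq {q Q : ℂ[X]} {c : ℂ} (hq : q * (X - C c) = Q) (L : ℕ) :
    (Fin.cons q fun a : Fin L => Q * X ^ (a : ℕ) : Fin (L + 1) → ℂ[X]) =
      fun a => q * (Fin.cons 1 fun a : Fin L => (X - C c) * X ^ (a : ℕ) : Fin (L + 1) → ℂ[X]) a := by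
  ext1 a
  refine Fin.cases ?_ (fun a => ?_) a <;> simp [← hq, mul_assoc]

theorem monic_cons_X_sub_C (c : ℂ) (L : ℕ) (a : Fin (L + 1)) :
    ((Fin.cons 1 fun a : Fin L => (X - C c) * X ^ (a : ℕ) : Fin (L + 1) → ℂ[X]) a).Monic := by
  refine Fin.cases ?_ (fun a => ?_) a
  · simp
  · exact (monic_X_sub_C c).mul (monic_X_pow _)

theorem natDegree_cons_X_sub_C (c : ℂ) (L : ℕ) (a : Fin (L + 1)) :
    ((Fin.cons 1 fun a : Fin L => (X - C c) * X ^ (a : ℕ) : Fin (L + 1) → ℂ[X]) a).natDegree =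
      a := by
  refine Fin.cases ?_ (fun a => ?_) a
  · simp
  · rw [Fin.cons_succ, (monic_X_sub_C c).natDegree_mul (monic_X_pow _), natDegree_X_sub_C,
      natDegree_X_pow, Fin.val_succ, add_comm]

theorem det_gramMatrix_cons_cons (β : ℂ[X] →ₗ[ℂ] ℂ[X] →ₗ[ℂ] ℂ) {q q' Q : ℂ[X]} {c c' : ℂ}
    (hq : q * (X - C c) = Q) (hq' : q' * (X - C c') = Q) (L : ℕ) :
    (gramMatrix β (Fin.cons q fun a : Fin L => Q * X ^ (a : ℕ) : Fin (L + 1) → ℂ[X])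
      (Fin.cons q' fun a : Fin L => Q * X ^ (a : ℕ) : Fin (L + 1) → ℂ[X])).det =
      gramDet β q q' (L + 1) := by
  rw [cons_mul_X_pow_eq hq, cons_mul_X_pow_eq hq']
  refine (det_functional_monic (fun b => β.flip _) q (monic_cons_X_sub_C c L)
    (natDegree_cons_X_sub_C c L)).trans ?_
  rw [← det_transpose]
  refine (det_functional_monic (fun b => β _) q' (monic_cons_X_sub_C c' L)
    (natDegree_cons_X_sub_C c' L)).trans ?_
  rw [← det_transpose]
  rfl

/-- The Gram determinant of `q, Q, Q X, …` against a functional `ψ` and `Q, Q X, …`. -/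
noncomputable def functionalDet (β : ℂ[X] →ₗ[ℂ] ℂ[X] →ₗ[ℂ] ℂ) (ψ : ℂ[X] →ₗ[ℂ] ℂ) (q Q : ℂ[X])
    (L : ℕ) : ℂ :=
  (of fun a b : Fin (L + 1) =>
    (Fin.cons ψ fun b : Fin L => β.flip (Q * X ^ (b : ℕ)) : Fin (L + 1) → ℂ[X] →ₗ[ℂ] ℂ) b
      ((Fin.cons q fun a : Fin L => Q * X ^ (a : ℕ) : Fin (L + 1) → ℂ[X]) a)).det

theorem functionalDet_eq_of_monic (β : ℂ[X] →ₗ[ℂ] ℂ[X] →ₗ[ℂ] ℂ) (ψ : ℂ[X] →ₗ[ℂ] ℂ)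
    {q Q : ℂ[X]} {c : ℂ} (hq : q * (X - C c) = Q) {L : ℕ} {u : Fin (L + 1) → ℂ[X]}
    (hu : ∀ a, (u a).Monic) (hdeg : ∀ a, (u a).natDegree = a) :
    functionalDet β ψ q Q L = (of fun a b : Fin (L + 1) =>
      (Fin.cons ψ fun b : Fin L => β.flip (Q * X ^ (b : ℕ)) : Fin (L + 1) → ℂ[X] →ₗ[ℂ] ℂ) b
        (q * u a)).det := by
  rw [functionalDet, cons_mul_X_pow_eq hq, det_functional_monic _ q hu hdeg]
  exact det_functional_monic _ q (monic_cons_X_sub_C c L) (natDegree_cons_X_sub_C c L)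

/-- In the family 1, X - x, (X - x)X, … the functional survives only on the first member; the
remaining minor acquires the factor X - x. -/
theorem functionalDet_eval (β : ℂ[X] →ₗ[ℂ] ℂ[X] →ₗ[ℂ] ℂ) (ψ : ℂ[X] →ₗ[ℂ] ℂ)
    {q Q : ℂ[X]} {c : ℂ} (hq : q * (X - C c) = Q) (L : ℕ) (x : ℂ)
    (hψ : ∀ a : Fin L, ψ (q * ((X - C x) * X ^ (a : ℕ))) = 0) :
    functionalDet β ψ q Q L = ψ q * gramDet β (q * (X - C x)) Q L := by
  rw [functionalDet_eq_of_monic β ψ hq (monic_cons_X_sub_C x L) (natDegree_cons_X_sub_C x L),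
    det_succ_column_zero, Fin.sum_univ_succ, Finset.sum_eq_zero fun a _ => by simp [hψ]]
  simp only [of_apply, Fin.val_zero, pow_zero, one_mul, Fin.cons_zero, mul_one, add_zero]
  congr 2
  ext a b
  simp [gramMatrix, mul_assoc]

/-- Here the functional survives only on q X^L, the last row, whence the cofactor sign (-1)^L. -/
theorem functionalDet_coeff (β : ℂ[X] →ₗ[ℂ] ℂ[X] →ₗ[ℂ] ℂ) (ψ : ℂ[X] →ₗ[ℂ] ℂ)
    {q Q : ℂ[X]} {c : ℂ} (hq : q * (X - C c) = Q) (L : ℕ)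
    (hψ : ∀ a : Fin L, ψ (q * X ^ (a : ℕ)) = 0) :
    functionalDet β ψ q Q L = (-1) ^ L * ψ (q * X ^ L) * gramDet β q Q L := by
  rw [functionalDet_eq_of_monic β ψ hq (u := fun a => X ^ (a : ℕ)) (fun a => monic_X_pow _)
    (fun a => natDegree_X_pow _),
    det_succ_column_zero, Fin.sum_univ_castSucc, Finset.sum_eq_zero fun a _ => by simp [hψ]]
  simp only [of_apply, Fin.val_last, Fin.cons_zero, zero_add]
  congr 2
  ext a b
  simp [gramMatrix]

/-- The Gram determinant of `Q, Q X, …` bordered by a row and a column of functional values. -/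
noncomputable def functionalPairDet (β : ℂ[X] →ₗ[ℂ] ℂ[X] →ₗ[ℂ] ℂ) (ρ ψ : ℂ[X] →ₗ[ℂ] ℂ)
    (Q : ℂ[X]) (L : ℕ) : ℂ :=
  (of (Fin.cons (Fin.cons 0 fun b : Fin L => ρ (Q * X ^ (b : ℕ)))
    fun a : Fin L => Fin.cons (ψ (Q * X ^ (a : ℕ))) fun b : Fin L =>
      β (Q * X ^ (a : ℕ)) (Q * X ^ (b : ℕ)) : Fin (L + 1) → Fin (L + 1) → ℂ)).det

theorem functionalPairDet_flip (β : ℂ[X] →ₗ[ℂ] ℂ[X] →ₗ[ℂ] ℂ) (ρ ψ : ℂ[X] →ₗ[ℂ] ℂ)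
    (Q : ℂ[X]) (L : ℕ) : functionalPairDet β.flip ψ ρ Q L = functionalPairDet β ρ ψ Q L := by
  rw [functionalPairDet, functionalPairDet, ← det_transpose]
  congr 1
  ext a b
  refine Fin.cases ?_ (fun a => ?_) a <;> refine Fin.cases ?_ (fun b => ?_) b <;> simp

theorem functionalPairDet_eq_of_monic_row (β : ℂ[X] →ₗ[ℂ] ℂ[X] →ₗ[ℂ] ℂ) (ρ ψ : ℂ[X] →ₗ[ℂ] ℂ)
    (Q : ℂ[X]) {L : ℕ} {u : Fin L → ℂ[X]} (v : Fin L → ℂ[X])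
    (hu : ∀ a, (u a).Monic) (hdeg : ∀ a, (u a).natDegree = a) :
    (of (Fin.cons (Fin.cons 0 fun b : Fin L => ρ (Q * v b))
      fun a : Fin L => Fin.cons (ψ (Q * X ^ (a : ℕ))) fun b : Fin L =>
        β (Q * X ^ (a : ℕ)) (Q * v b) : Fin (L + 1) → Fin (L + 1) → ℂ)).det =
    (of (Fin.cons (Fin.cons 0 fun b : Fin L => ρ (Q * v b))
      fun a : Fin L => Fin.cons (ψ (Q * u a)) fun b : Fin L =>
        β (Q * u a) (Q * v b) : Fin (L + 1) → Fin (L + 1) → ℂ)).det := by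
  have h := det_cons_functional_monic (Fin.cons 0 fun b : Fin L => ρ (Q * v b))
    (Fin.cons ψ fun b => β.flip (Q * v b)) Q hu hdeg
  have aux : ∀ w : Fin L → ℂ[X], (fun a b =>
      (Fin.cons ψ fun b => β.flip (Q * v b) : Fin (L + 1) → ℂ[X] →ₗ[ℂ] ℂ) b (Q * w a)) =
      fun a : Fin L => (Fin.cons (ψ (Q * w a)) fun b : Fin L =>
        β (Q * w a) (Q * v b) : Fin (L + 1) → ℂ) := by
    intro w
    ext a b
    refine Fin.cases ?_ (fun b => ?_) b <;> simp
  rw [aux u, aux fun a => X ^ (a : ℕ)] at h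
  exact h.symm

theorem functionalPairDet_eq_of_monic (β : ℂ[X] →ₗ[ℂ] ℂ[X] →ₗ[ℂ] ℂ) (ρ ψ : ℂ[X] →ₗ[ℂ] ℂ)
    (Q : ℂ[X]) {L : ℕ} {u v : Fin L → ℂ[X]} (hu : ∀ a, (u a).Monic)
    (hudeg : ∀ a, (u a).natDegree = a) (hv : ∀ a, (v a).Monic)
    (hvdeg : ∀ a, (v a).natDegree = a) :
    functionalPairDet β ρ ψ Q L = (of (Fin.cons (Fin.cons 0 fun b : Fin L => ρ (Q * v b))
      fun a : Fin L => Fin.cons (ψ (Q * u a)) fun b : Fin L =>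
        β (Q * u a) (Q * v b) : Fin (L + 1) → Fin (L + 1) → ℂ)).det := by
  have transpose : ∀ (β : ℂ[X] →ₗ[ℂ] ℂ[X] →ₗ[ℂ] ℂ) (ρ ψ : ℂ[X] →ₗ[ℂ] ℂ) (u v : Fin L → ℂ[X]),
      (of (Fin.cons (Fin.cons 0 fun b : Fin L => ρ (Q * v b))
        fun a : Fin L => Fin.cons (ψ (Q * u a)) fun b : Fin L =>
          β (Q * u a) (Q * v b) : Fin (L + 1) → Fin (L + 1) → ℂ)).det =
      (of (Fin.cons (Fin.cons 0 fun b : Fin L => ψ (Q * u b))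
        fun a : Fin L => Fin.cons (ρ (Q * v a)) fun b : Fin L =>
          β.flip (Q * v a) (Q * u b) : Fin (L + 1) → Fin (L + 1) → ℂ)).det := by
    intro β ρ ψ u v
    rw [← det_transpose]
    congr 1
    ext a b
    refine Fin.cases ?_ (fun a => ?_) a <;> refine Fin.cases ?_ (fun b => ?_) b <;> simp
  rw [← functionalPairDet_eq_of_monic_row β ρ ψ Q v hu hudeg, transpose,
    ← functionalPairDet_eq_of_monic_row β.flip ψ ρ Q _ hv hvdeg, ← functionalPairDet_flip]
  rfl

theorem functionalPairDet_expand (β : ℂ[X] →ₗ[ℂ] ℂ[X] →ₗ[ℂ] ℂ) (ρ ψ : ℂ[X] →ₗ[ℂ] ℂ)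
    (Q : ℂ[X]) {L : ℕ} {u : Fin (L + 1) → ℂ[X]} (x : ℂ) (hu : ∀ a, (u a).Monic)
    (hudeg : ∀ a, (u a).natDegree = a) (hρ : ∀ b : Fin L, ρ (Q * ((X - C x) * X ^ (b : ℕ))) = 0) :
    functionalPairDet β ρ ψ Q (L + 1) = -ρ Q * (of fun a : Fin (L + 1) =>
      (Fin.cons (ψ (Q * u a)) fun b : Fin L => β (Q * u a) (Q * (X - C x) * X ^ (b : ℕ)) :
        Fin (L + 1) → ℂ)).det := by
  -- The corner is 0, so the only surviving entry of the first row is ρ(Q) in the second column;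
  -- this is the source of the minus sign.
  rw [functionalPairDet_eq_of_monic β ρ ψ Q hu hudeg (monic_cons_X_sub_C x L)
    (natDegree_cons_X_sub_C x L), det_succ_row_zero, Fin.sum_univ_succ, Fin.sum_univ_succ,
    Finset.sum_eq_zero fun b _ => by simp [hρ]]
  simp only [of_apply, Fin.cons_zero, mul_zero, zero_mul, Fin.cons_succ, zero_add, add_zero,
    Fin.val_succ, Fin.val_zero, pow_one, mul_one, neg_one_mul]
  congr 2
  ext a b
  refine Fin.cases ?_ (fun b => ?_) b
  · simp
  · simp [Fin.succAbove, Fin.lt_def, mul_assoc]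

theorem functionalPairDet_eval_eval (β : ℂ[X] →ₗ[ℂ] ℂ[X] →ₗ[ℂ] ℂ) (ρ ψ : ℂ[X] →ₗ[ℂ] ℂ)
    (Q : ℂ[X]) (L : ℕ) (x y : ℂ)
    (hρ : ∀ b : Fin L, ρ (Q * ((X - C x) * X ^ (b : ℕ))) = 0)
    (hψ : ∀ b : Fin L, ψ (Q * ((X - C y) * X ^ (b : ℕ))) = 0) :
    functionalPairDet β ρ ψ Q (L + 1) =
      -ρ Q * ψ Q * gramDet β (Q * (X - C y)) (Q * (X - C x)) L := by
  rw [functionalPairDet_expand β ρ ψ Q x (monic_cons_X_sub_C y L) (natDegree_cons_X_sub_C y L) hρ,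
    det_succ_column_zero, Fin.sum_univ_succ, Finset.sum_eq_zero fun a _ => by simp [hψ]]
  simp only [of_apply, Fin.val_zero, pow_zero, one_mul, Fin.cons_zero, mul_one, add_zero]
  rw [mul_assoc (-ρ Q), gramDet]
  congr 3
  ext a b
  simp [gramMatrix, mul_assoc]

theorem functionalPairDet_eval_coeff (β : ℂ[X] →ₗ[ℂ] ℂ[X] →ₗ[ℂ] ℂ) (ρ ψ : ℂ[X] →ₗ[ℂ] ℂ)
    (Q : ℂ[X]) (L : ℕ) (x : ℂ)
    (hρ : ∀ b : Fin L, ρ (Q * ((X - C x) * X ^ (b : ℕ))) = 0)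
    (hψ : ∀ b : Fin L, ψ (Q * X ^ (b : ℕ)) = 0) :
    functionalPairDet β ρ ψ Q (L + 1) =
      -ρ Q * ((-1) ^ L * ψ (Q * X ^ L)) * gramDet β Q (Q * (X - C x)) L := by
  rw [functionalPairDet_expand β ρ ψ Q x (u := fun a => X ^ (a : ℕ)) (fun a => monic_X_pow _)
    (fun a => natDegree_X_pow _) hρ,
    det_succ_column_zero, Fin.sum_univ_castSucc, Finset.sum_eq_zero fun a _ => by simp [hψ]]
  simp only [of_apply, Fin.val_last, Fin.cons_zero, zero_add]
  rw [mul_assoc (-ρ Q), gramDet]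
  congr 3
  ext a b
  simp [gramMatrix]

variable {J : Type*} [Fintype J] [DecidableEq J]

omit [Fintype J] [DecidableEq J] in
theorem cons_inl {L : ℕ} (q : ℂ[X]) (f : Fin L → ℂ[X]) (a : Fin (L + 1)) :
    (Fin.cons (q, 0) (fun a => (f a, 0)) : Fin (L + 1) → ℂ[X] × (J → ℂ)) a =
      ((Fin.cons q f : Fin (L + 1) → ℂ[X]) a, 0) := by
  refine Fin.cases ?_ (fun a => ?_) a <;> simp

omit [DecidableEq J] in
theorem borderDet_inl_inl (β : ℂ[X] →ₗ[ℂ] ℂ[X] →ₗ[ℂ] ℂ) (φ : J → ℂ[X] →ₗ[ℂ] ℂ)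
    {q q' Q : ℂ[X]} {c c' : ℂ} (hq : q * (X - C c) = Q) (hq' : q' * (X - C c') = Q) (L : ℕ) :
    borderDet β φ Q L (q, 0) (q', 0) = gramDet β q q' (L + 1) := by
  rw [← det_gramMatrix_cons_cons β hq hq', borderDet]
  congr 1
  ext a b
  rw [gramMatrix_apply, gramMatrix_apply, cons_inl, cons_inl, borderedForm_inl_inl]

theorem borderDet_inl_functional (β : ℂ[X] →ₗ[ℂ] ℂ[X] →ₗ[ℂ] ℂ) (φ : J → ℂ[X] →ₗ[ℂ] ℂ)
    (q Q : ℂ[X]) (L : ℕ) (j : J) :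
    borderDet β φ Q L (q, 0) (functionalVector j) = functionalDet β (φ j) q Q L := by
  rw [borderDet, functionalDet]
  congr 1
  ext a b
  rw [gramMatrix_apply, cons_inl]
  refine Fin.cases ?_ (fun b => ?_) b
  · simp [borderedForm_inl_functional]
  · simp [borderedForm_inl_inl]

theorem borderDet_functional_inl (β : ℂ[X] →ₗ[ℂ] ℂ[X] →ₗ[ℂ] ℂ) (φ : J → ℂ[X] →ₗ[ℂ] ℂ)
    (q Q : ℂ[X]) (L : ℕ) (j : J) :
    borderDet β φ Q L (functionalVector j) (q, 0) = functionalDet β.flip (-φ j) q Q L := by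
  rw [borderDet, functionalDet, ← det_transpose]
  congr 1
  ext a b
  rw [transpose_apply, gramMatrix_apply, cons_inl]
  refine Fin.cases ?_ (fun b => ?_) b
  · simp [borderedForm_functional_inl]
  · simp [borderedForm_inl_inl]

theorem borderDet_functional_functional (β : ℂ[X] →ₗ[ℂ] ℂ[X] →ₗ[ℂ] ℂ)
    (φ : J → ℂ[X] →ₗ[ℂ] ℂ) (Q : ℂ[X]) (L : ℕ) (i j : J) :
    borderDet β φ Q L (functionalVector i) (functionalVector j) =
      functionalPairDet β (-φ i) (φ j) Q L := by
  rw [borderDet, functionalPairDet]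
  congr 1
  ext a b
  rw [gramMatrix_apply]
  refine Fin.cases ?_ (fun a => ?_) a <;> refine Fin.cases ?_ (fun b => ?_) b <;>
    simp [borderedForm_functional_inl, borderedForm_inl_inl, borderedForm_inl_functional,
      borderedForm_functional_functional]

end BorderDeterminants

/-! ### Andréief's identity for one and two sets of variables -/

section Andreief

open Matrix

variable {X : Type*} [MeasurableSpace X] {μ : Measure X} [SigmaFinite μ] {n : ℕ}

theorem integrable_det_pi {f : Fin n → X → ℂ} (hf : ∀ a, Integrable (f a) μ) :
    Integrable (fun x : Fin n → X => (of fun a j => f a (x j)).det) (Measure.pi fun _ => μ) := by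
  simp only [det_apply']
  refine integrable_finsetSum _ fun σ _ => Integrable.const_mul ?_ _
  exact Integrable.fintype_prod (f := fun j => f (σ j)) fun j => hf (σ j)

/-- **Andréief's identity**. -/
theorem integral_det_mul_det {f g : Fin n → X → ℂ}
    (h : ∀ a b, Integrable (fun x => f a x * g b x) μ) :
    ∫ x : Fin n → X, (of fun a j => f a (x j)).det * (of fun b j => g b (x j)).det
        ∂(Measure.pi fun _ => μ) =
      (n.factorial : ℂ) * (of fun a b => ∫ x, f a x * g b x ∂μ).det := by
  set M : Matrix (Fin n) (Fin n) ℂ := of fun a b => ∫ x, f a x * g b x ∂μ with hM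
  have hexpand : ∀ x : Fin n → X,
      (of fun a j => f a (x j)).det * (of fun b j => g b (x j)).det =
        ∑ σ : Equiv.Perm (Fin n), ∑ τ : Equiv.Perm (Fin n),
          (((σ.sign : ℤ) : ℂ) * ((τ.sign : ℤ) : ℂ)) * ∏ j, f (σ j) (x j) * g (τ j) (x j) := by
    intro x
    rw [det_apply', det_apply', Finset.sum_mul_sum]
    refine Finset.sum_congr rfl fun σ _ => Finset.sum_congr rfl fun τ _ => ?_
    rw [Finset.prod_mul_distrib]
    simp only [of_apply]
    ring
  have hint : ∀ σ τ : Equiv.Perm (Fin n), Integrable (fun x : Fin n → X =>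
      (((σ.sign : ℤ) : ℂ) * ((τ.sign : ℤ) : ℂ)) * ∏ j, f (σ j) (x j) * g (τ j) (x j))
      (Measure.pi fun _ => μ) := fun σ τ =>
    (Integrable.fintype_prod (f := fun j x => f (σ j) x * g (τ j) x) fun j => h _ _).const_mul _
  simp only [hexpand]
  rw [integral_finsetSum _ fun σ _ => integrable_finsetSum _ fun τ _ => hint σ τ]
  -- Each σ contributes the same det M: permuting the rows by σ produces a second factor sign σ.
  -- Summing over σ gives n!.
  have hσ : ∀ σ : Equiv.Perm (Fin n), ∫ x : Fin n → X, ∑ τ : Equiv.Perm (Fin n),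
      (((σ.sign : ℤ) : ℂ) * ((τ.sign : ℤ) : ℂ)) * ∏ j, f (σ j) (x j) * g (τ j) (x j)
        ∂(Measure.pi fun _ => μ) = M.det := by
    intro σ
    rw [integral_finsetSum _ fun τ _ => hint σ τ]
    have hterm : ∀ τ : Equiv.Perm (Fin n), ∫ x : Fin n → X,
        (((σ.sign : ℤ) : ℂ) * ((τ.sign : ℤ) : ℂ)) * ∏ j, f (σ j) (x j) * g (τ j) (x j)
          ∂(Measure.pi fun _ => μ) =
        ((σ.sign : ℤ) : ℂ) * (((τ.sign : ℤ) : ℂ) * ∏ j, (M.submatrix σ id)ᵀ (τ j) j) := by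
      intro τ
      rw [integral_const_mul,
        integral_fintype_prod_eq_prod (f := fun j x => f (σ j) x * g (τ j) x), mul_assoc]
      rfl
    simp only [hterm]
    rw [← Finset.mul_sum, ← det_apply', det_transpose, det_permute, ← mul_assoc]
    have : ((σ.sign : ℤ) : ℂ) * ((σ.sign : ℤ) : ℂ) = 1 := by
      rcases Int.units_eq_one_or σ.sign with h | h <;> simp [h]
    rw [this, one_mul]
  simp only [hσ]
  rw [Finset.sum_const, Finset.card_univ, Fintype.card_perm, Fintype.card_fin, nsmul_eq_mul]

/-- Andréief's identity is applied in y for fixed x, and then in x. Boundedness of w reduces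
integrability to that of the one-variable functions. -/
theorem integral_det_mul_det_mul_det {f g : Fin n → X → ℂ} {w : X → X → ℂ} {c : ℝ}
    (hf : ∀ a, Integrable (f a) μ) (hg : ∀ a, Integrable (g a) μ)
    (hw : Measurable fun z : X × X => w z.1 z.2) (hwc : ∀ x y, ‖w x y‖ ≤ c) :
    ∫ p : (Fin n → X) × (Fin n → X), (of fun a j => f a (p.1 j)).det *
        ((of fun b j => g b (p.2 j)).det * (of fun i j => w (p.1 i) (p.2 j)).det)
        ∂((Measure.pi fun _ => μ).prod (Measure.pi fun _ => μ)) =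
      (n.factorial : ℂ) ^ 2 *
        (of fun a b => ∫ z, f a z.1 * g b z.2 * w z.1 z.2 ∂(μ.prod μ)).det := by
  have hwx : ∀ x, Measurable (w x) := fun x => hw.comp (measurable_const.prodMk measurable_id)
  have hgw : ∀ x b, Integrable (fun y => g b y * w x y) μ := fun x b =>
    (hg b).mul_bdd (c := c) (hwx x).aestronglyMeasurable (Filter.Eventually.of_forall (hwc x))
  have hfgw : ∀ a b, Integrable (fun z : X × X => f a z.1 * g b z.2 * w z.1 z.2) (μ.prod μ) :=
    fun a b => ((hf a).mul_prod (hg b)).mul_bdd (c := c) hw.aestronglyMeasurable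
      (Filter.Eventually.of_forall fun z => hwc z.1 z.2)
  have hdetw : Measurable fun p : (Fin n → X) × (Fin n → X) =>
      (of fun i j => w (p.1 i) (p.2 j)).det := by
    simp only [det_apply', of_apply]
    refine Finset.measurable_sum _ fun σ _ => Measurable.const_mul ?_ _
    refine Finset.measurable_prod _ fun j _ => ?_
    exact hw.comp (g := fun z : X × X => w z.1 z.2)
      (f := fun p : (Fin n → X) × (Fin n → X) => (p.1 (σ j), p.2 j))
      (((measurable_pi_apply (σ j)).comp measurable_fst).prodMk
        ((measurable_pi_apply j).comp measurable_snd))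
  have hdetc : ∀ p : (Fin n → X) × (Fin n → X),
      ‖(of fun i j => w (p.1 i) (p.2 j)).det‖ ≤ n.factorial • c ^ n := by
    intro p
    rw [det_apply']
    refine (norm_sum_le _ _).trans ?_
    have : ∀ σ ∈ (Finset.univ : Finset (Equiv.Perm (Fin n))),
        ‖((σ.sign : ℤ) : ℂ) * ∏ j, (of fun i j => w (p.1 i) (p.2 j)) (σ j) j‖ ≤ c ^ n := by
      intro σ _
      rw [norm_mul, norm_prod]
      have hs : ‖((σ.sign : ℤ) : ℂ)‖ = 1 := by
        rcases Int.units_eq_one_or σ.sign with h | h <;> simp [h]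
      rw [hs, one_mul]
      calc ∏ j, ‖(of fun i j => w (p.1 i) (p.2 j)) (σ j) j‖ ≤ ∏ _j : Fin n, c :=
            Finset.prod_le_prod (fun _ _ => norm_nonneg _) fun j _ => hwc _ _
        _ = c ^ n := by simp
    refine (Finset.sum_le_card_nsmul _ _ _ this).trans_eq ?_
    rw [Finset.card_univ, Fintype.card_perm, Fintype.card_fin]
  have hint : Integrable (fun p : (Fin n → X) × (Fin n → X) =>
      (of fun a j => f a (p.1 j)).det * ((of fun b j => g b (p.2 j)).det *
        (of fun i j => w (p.1 i) (p.2 j)).det))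
      ((Measure.pi fun _ => μ).prod (Measure.pi fun _ => μ)) := by
    simp only [← mul_assoc]
    exact ((integrable_det_pi hf).mul_prod (integrable_det_pi hg)).mul_bdd
      hdetw.aestronglyMeasurable (Filter.Eventually.of_forall hdetc)
  rw [integral_prod _ hint]
  have hinner : ∀ x : Fin n → X, ∫ y : Fin n → X, (of fun a j => f a (x j)).det *
      ((of fun b j => g b (y j)).det * (of fun i j => w (x i) (y j)).det)
        ∂(Measure.pi fun _ => μ) =
      (n.factorial : ℂ) * ((of fun a j => f a (x j)).det *
        (of fun b j => ∫ y, g b y * w (x j) y ∂μ).det) := by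
    intro x
    rw [integral_const_mul, integral_det_mul_det fun b i => hgw (x i) b]
    ring
  simp only [hinner]
  have hprod : ∀ a b, (fun x => ∫ y, f a x * g b y * w x y ∂μ) =
      fun x => f a x * ∫ y, g b y * w x y ∂μ := by
    intro a b
    ext x
    simp only [mul_assoc, integral_const_mul]
  rw [integral_const_mul, integral_det_mul_det (f := f) (g := fun b x => ∫ y, g b y * w x y ∂μ)]
  · rw [← mul_assoc, ← sq]
    congr 3
    ext a b
    rw [integral_prod _ (hfgw a b)]
    simp only [hprod]
  · intro a b
    rw [← hprod]
    exact (hfgw a b).integral_prod_left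

end Andreief

/-! ### The partition function as a determinant of double integrals -/

section CauchyPartition

open Matrix Polynomial

/-- The function `y / (x + y)` on the positive quadrant, extended by a bounded function. -/
noncomputable def cauchyWeight (x y : ℝ) : ℂ := ((max y 0 / (max x 0 + max y 0) : ℝ) : ℂ)

theorem measurable_cauchyWeight : Measurable fun z : ℝ × ℝ => cauchyWeight z.1 z.2 := by
  unfold cauchyWeight
  fun_prop

theorem norm_cauchyWeight_le (x y : ℝ) : ‖cauchyWeight x y‖ ≤ 1 := by
  have hx : 0 ≤ max x 0 := le_max_right _ _
  have hy : 0 ≤ max y 0 := le_max_right _ _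
  rw [cauchyWeight, Complex.norm_real, Real.norm_of_nonneg (by positivity)]
  exact div_le_one_of_le₀ (by linarith) (by positivity)

theorem cauchyWeight_of_pos {x y : ℝ} (hx : 0 < x) (hy : 0 < y) :
    cauchyWeight x y = (y : ℂ) * ((x : ℂ) + y)⁻¹ := by
  rw [cauchyWeight, max_eq_left hx.le, max_eq_left hy.le]
  push_cast
  rw [div_eq_mul_inv]

theorem cauchyWeight_add_swap {x y : ℝ} (hx : 0 < x) (hy : 0 < y) :
    cauchyWeight x y + cauchyWeight y x = 1 := by
  rw [cauchyWeight_of_pos hx hy, cauchyWeight_of_pos hy hx, add_comm (y : ℂ) x]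
  have : (x : ℂ) + y ≠ 0 := by exact_mod_cast (add_pos hx hy).ne'
  field_simp
  ring

/-- The pairing of one-variable functions that underlies the Cauchy two-matrix model. -/
noncomputable def cauchyPairing (α : ℝ → ℂ) (f g : ℝ → ℂ) : ℂ :=
  ∫ z : ℝ × ℝ, f z.1 * α z.1 * (g z.2 * α z.2) * cauchyWeight z.1 z.2
    ∂((volume.restrict (Set.Ioi 0)).prod (volume.restrict (Set.Ioi 0)))

theorem ae_pos_prod : ∀ᵐ z : ℝ × ℝ
    ∂((volume.restrict (Set.Ioi 0)).prod (volume.restrict (Set.Ioi 0))), 0 < z.1 ∧ 0 < z.2 := by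
  rw [Measure.prod_restrict]
  exact ae_restrict_mem (measurableSet_Ioi.prod measurableSet_Ioi)

theorem ae_pos_positiveLebesgue (N : ℕ) : ∀ᵐ x ∂(positiveLebesgue N), ∀ j, 0 < x j := by
  rw [ae_all_iff]
  intro j
  exact (Measure.tendsto_eval_ae_ae (i := j)).eventually
    (ae_restrict_mem measurableSet_Ioi : ∀ᵐ t : ℝ ∂(volume.restrict (Set.Ioi 0)), t ∈ Set.Ioi 0)

theorem det_weighted_powers {N : ℕ} (r : ℝ → ℂ) (x : Fin N → ℝ) :
    (of fun a j : Fin N => r (x j) * (x j : ℂ) ^ (a : ℕ)).det =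
      (∏ j, r (x j)) * ((vandermondeProd x : ℝ) : ℂ) := by
  rw [show (of fun a j : Fin N => r (x j) * (x j : ℂ) ^ (a : ℕ)) =
    of fun a j : Fin N => r (x j) * (vandermonde fun j => (x j : ℂ))ᵀ a j from rfl,
    det_mul_row, det_transpose, ← vandermondeProd_eq_det]
  simp [vandermondeProd]

/-- One factor Δ(x)Δ(y) together with ∏(x_i + y_j)⁻¹ is a Cauchy determinant. Its columns absorb the
y_j, giving the bounded kernel y/(x+y); the other Vandermonde factors carry the weights. -/
theorem cauchyPartition_eq_det (α : ℝ → ℂ) (N : ℕ) {k₁ l₁ k₂ l₂ : ℕ}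
    (kap₁ : Fin k₁ → ℂ) (lam₁ : Fin l₁ → ℂ) (kap₂ : Fin k₂ → ℂ) (lam₂ : Fin l₂ → ℂ)
    (h₁ : ∀ a < N, IntegrableOn (fun x : ℝ => charRatio kap₁ lam₁ x * (x : ℂ) ^ a * α x)
      (Set.Ioi 0))
    (h₂ : ∀ a < N, IntegrableOn (fun x : ℝ => charRatio kap₂ lam₂ x * (x : ℂ) ^ a * α x)
      (Set.Ioi 0)) :
    cauchyPartition α N kap₁ lam₁ kap₂ lam₂ =
      (of fun a b : Fin N => cauchyPairing α (fun x => charRatio kap₁ lam₁ x * (x : ℂ) ^ (a : ℕ))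
        fun x => charRatio kap₂ lam₂ x * (x : ℂ) ^ (b : ℕ)).det := by
  have hfact : ((N.factorial : ℂ) ^ 2) ≠ 0 := pow_ne_zero _ (by exact_mod_cast N.factorial_ne_zero)
  rw [cauchyPartition, one_div, inv_mul_eq_iff_eq_mul₀ hfact]
  refine Eq.trans ?_ (integral_det_mul_det_mul_det (μ := volume.restrict (Set.Ioi (0 : ℝ)))
    (f := fun (a : Fin N) x => charRatio kap₁ lam₁ x * (x : ℂ) ^ (a : ℕ) * α x)
    (g := fun (b : Fin N) x => charRatio kap₂ lam₂ x * (x : ℂ) ^ (b : ℕ) * α x)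
    (w := cauchyWeight) (c := 1)
    (fun a => h₁ a a.2) (fun b => h₂ b b.2) measurable_cauchyWeight norm_cauchyWeight_le)
  refine integral_congr_ae ?_
  have hx := Measure.quasiMeasurePreserving_fst (μ := positiveLebesgue N)
    (ν := positiveLebesgue N) |>.ae (ae_pos_positiveLebesgue N)
  have hy := Measure.quasiMeasurePreserving_snd (μ := positiveLebesgue N)
    (ν := positiveLebesgue N) |>.ae (ae_pos_positiveLebesgue N)
  filter_upwards [hx, hy] with p hx hy
  have hF : ∀ (r : ℝ → ℂ) (x : Fin N → ℝ),
      (of fun a j : Fin N => r (x j) * (x j : ℂ) ^ (a : ℕ) * α (x j)).det =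
        (∏ j, (r (x j) * α (x j))) * ((vandermondeProd x : ℝ) : ℂ) := by
    intro r x
    rw [← det_weighted_powers (fun t => r t * α t)]
    congr 1
    ext a j
    simp only [of_apply]
    ring
  have hW : (of fun i j => cauchyWeight (p.1 i) (p.2 j)).det = (∏ j, (p.2 j : ℂ)) *
      ((vandermondeProd p.1 * vandermondeProd p.2 / ∏ i, ∏ j, (p.1 i + p.2 j) : ℝ) : ℂ) := by
    have hC := det_cauchy p.1 p.2 fun i j => (add_pos (hx i) (hy j)).ne'
    rw [← hC, ← Complex.ofRealHom_eq_coe, Complex.ofRealHom.map_det, ← det_mul_row]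
    congr 1
    ext i j
    simp [cauchyWeight_of_pos (hx i) (hy j)]
  rw [hF, hF, hW]
  simp only [Finset.prod_mul_distrib]
  push_cast
  ring

theorem exists_norm_one_add_div_sub_le {c : ℂ} (hc : ∀ t : ℝ, 0 ≤ t → c ≠ (t : ℂ)) :
    ∃ C : ℝ, ∀ x : ℝ, 0 ≤ x → (1 + x) / ‖(x : ℂ) - c‖ ≤ C := by
  obtain ⟨δ, hδ, hle⟩ : ∃ δ : ℝ, 0 < δ ∧ ∀ x : ℝ, 0 ≤ x → δ ≤ ‖(x : ℂ) - c‖ := by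
    by_cases him : c.im = 0
    · have hre : c.re < 0 := by
        by_contra! h
        exact hc c.re h (Complex.ext (by simp) (by simp [him]))
      refine ⟨-c.re, by linarith, fun x hx => le_trans ?_ (Complex.abs_re_le_norm _)⟩
      rw [Complex.sub_re, Complex.ofReal_re]
      exact le_trans (by linarith) (le_abs_self _)
    · refine ⟨|c.im|, abs_pos.2 him, fun x _ => le_trans ?_ (Complex.abs_im_le_norm _)⟩
      simp
  -- The constant comes from 1 + x ≤ |x - c| + 1 + |c|, with δ a lower bound for |x - c|.
  refine ⟨1 + (1 + ‖c‖) / δ, fun x hx => ?_⟩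
  have hpos : 0 < ‖(x : ℂ) - c‖ := hδ.trans_le (hle x hx)
  have hxle : x ≤ ‖(x : ℂ) - c‖ + ‖c‖ := by
    calc x = ‖(x : ℂ)‖ := by rw [Complex.norm_real, Real.norm_of_nonneg hx]
      _ = ‖((x : ℂ) - c) + c‖ := by rw [sub_add_cancel]
      _ ≤ _ := norm_add_le _ _
  calc (1 + x) / ‖(x : ℂ) - c‖ ≤ (‖(x : ℂ) - c‖ + (1 + ‖c‖)) / ‖(x : ℂ) - c‖ := by
        refine div_le_div_of_nonneg_right ?_ hpos.le
        linarith
    _ = 1 + (1 + ‖c‖) / ‖(x : ℂ) - c‖ := by rw [add_div, div_self hpos.ne']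
    _ ≤ 1 + (1 + ‖c‖) / δ := by
        gcongr
        exact hle x hx

theorem eval_prod_X_sub_C {k : ℕ} (kap : Fin k → ℂ) (x : ℂ) :
    (∏ i, (X - C (kap i)) : ℂ[X]).eval x = ∏ i, (x - kap i) := by
  simp [eval_prod]

theorem integrableOn_pow_div {k L : ℕ} {kap : Fin k → ℂ}
    (hkap : ∀ i, ∀ t : ℝ, 0 ≤ t → kap i ≠ (t : ℂ)) {α : ℝ → ℂ} (hL : 0 < L)
    (hα : ∀ n < L, IntegrableOn (fun x : ℝ => (x : ℂ) ^ n * α x) (Set.Ioi 0)) {a : ℕ}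
    (ha : a < k + L) :
    IntegrableOn (fun x : ℝ => (x : ℂ) ^ a / (∏ i, (X - C (kap i)) : ℂ[X]).eval (x : ℂ) * α x)
      (Set.Ioi 0) := by
  simp only [eval_prod_X_sub_C]
  -- Up to k powers of x are absorbed by the denominator, leaving an integrable moment of order
  -- below L. For a ≤ k this is the zeroth moment, so L > 0 is needed.
  obtain ⟨c, d, hc, hd, rfl⟩ : ∃ c d, c < L ∧ d ≤ k ∧ a = d + c := by
    rcases le_total a k with h | h
    · exact ⟨0, a, hL, h, rfl⟩
    · exact ⟨a - k, k, by omega, le_rfl, by omega⟩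
  choose B hB using fun i => exists_norm_one_add_div_sub_le (hkap i)
  have hbound : ∀ᵐ x : ℝ ∂(volume.restrict (Set.Ioi 0)),
      ‖(x : ℂ) ^ d / ∏ i, ((x : ℂ) - kap i)‖ ≤ ∏ i, B i := by
    filter_upwards [ae_restrict_mem measurableSet_Ioi] with x hx
    have hx : 0 < x := hx
    calc ‖(x : ℂ) ^ d / ∏ i, ((x : ℂ) - kap i)‖ = x ^ d / ∏ i, ‖(x : ℂ) - kap i‖ := by
          rw [norm_div, norm_pow, Complex.norm_real, Real.norm_of_nonneg hx.le, norm_prod]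
      _ ≤ (1 + x) ^ k / ∏ i, ‖(x : ℂ) - kap i‖ := by
          gcongr
          exact (pow_le_pow_left₀ hx.le (by linarith) d).trans
            (pow_le_pow_right₀ (by linarith) hd)
      _ = ∏ i, (1 + x) / ‖(x : ℂ) - kap i‖ := by
          rw [Finset.prod_div_distrib]
          simp
      _ ≤ ∏ i, B i := Finset.prod_le_prod (fun i _ => by positivity) fun i _ => hB i x hx.le
  have hmeas : Measurable fun x : ℝ => (x : ℂ) ^ d / ∏ i, ((x : ℂ) - kap i) := by fun_prop
  refine ((hα c hc).bdd_mul hmeas.aestronglyMeasurable hbound).congr ?_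
  refine Filter.Eventually.of_forall fun x => ?_
  simp only [pow_add]
  ring

end CauchyPartition

/-! ### The bilinear form on polynomials -/

section CauchyForm

open Matrix Polynomial

theorem cauchyPairing_congr {α f f' g g' : ℝ → ℂ} (hf : ∀ x, 0 < x → f x = f' x)
    (hg : ∀ x, 0 < x → g x = g' x) : cauchyPairing α f g = cauchyPairing α f' g' := by
  refine integral_congr_ae ?_
  filter_upwards [ae_pos_prod] with z hz
  rw [hf _ hz.1, hg _ hz.2]

theorem integrable_cauchyPairing {α f g : ℝ → ℂ}
    (hf : IntegrableOn (fun x => f x * α x) (Set.Ioi 0))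
    (hg : IntegrableOn (fun x => g x * α x) (Set.Ioi 0)) :
    Integrable (fun z : ℝ × ℝ => f z.1 * α z.1 * (g z.2 * α z.2) * cauchyWeight z.1 z.2)
      ((volume.restrict (Set.Ioi 0)).prod (volume.restrict (Set.Ioi 0))) :=
  (hf.mul_prod hg).mul_bdd (c := 1) measurable_cauchyWeight.aestronglyMeasurable
    (Filter.Eventually.of_forall fun z => norm_cauchyWeight_le z.1 z.2)

theorem cauchyPairing_add_swap {α f g : ℝ → ℂ}
    (hf : IntegrableOn (fun x => f x * α x) (Set.Ioi 0))
    (hg : IntegrableOn (fun x => g x * α x) (Set.Ioi 0)) :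
    cauchyPairing α f g + cauchyPairing α g f =
      (∫ x in Set.Ioi 0, f x * α x) * ∫ x in Set.Ioi 0, g x * α x := by
  have hswap : Integrable (fun z : ℝ × ℝ => g z.swap.1 * α z.swap.1 *
      (f z.swap.2 * α z.swap.2) * cauchyWeight z.swap.1 z.swap.2)
      ((volume.restrict (Set.Ioi 0)).prod (volume.restrict (Set.Ioi 0))) :=
    (integrable_cauchyPairing hg hf).swap
  rw [cauchyPairing, cauchyPairing, ← integral_prod_swap (μ := volume.restrict (Set.Ioi 0))
    (ν := volume.restrict (Set.Ioi 0)) (fun z : ℝ × ℝ => g z.1 * α z.1 * (f z.2 * α z.2) *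
      cauchyWeight z.1 z.2), ← integral_add (integrable_cauchyPairing hf hg) hswap,
    ← integral_prod_mul]
  refine integral_congr_ae ?_
  filter_upwards [ae_pos_prod] with z hz
  have h := cauchyWeight_add_swap hz.1 hz.2
  simp only [Prod.fst_swap, Prod.snd_swap]
  linear_combination (f z.1 * α z.1 * (g z.2 * α z.2)) * h

/-- The bilinear form `(p, q) ↦ cauchyPairing α (p / Q) (q / Q)` on polynomials of degree less than
`n`, extended to all polynomials by truncation. -/
noncomputable def cauchyForm (α : ℝ → ℂ) (Q : ℂ[X]) (n : ℕ) : ℂ[X] →ₗ[ℂ] ℂ[X] →ₗ[ℂ] ℂ :=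
  LinearMap.mk₂ ℂ (fun p q => ∑ a : Fin n, ∑ b : Fin n, p.coeff a * q.coeff b *
      cauchyPairing α (fun x => (x : ℂ) ^ (a : ℕ) / Q.eval (x : ℂ))
        fun x => (x : ℂ) ^ (b : ℕ) / Q.eval (x : ℂ))
    (fun p p' q => by simp only [coeff_add, add_mul, Finset.sum_add_distrib])
    (fun c p q => by simp only [coeff_smul, smul_eq_mul, Finset.mul_sum, mul_assoc])
    (fun p q q' => by simp only [coeff_add, mul_add, add_mul, Finset.sum_add_distrib])
    (fun c p q => by
      simp only [coeff_smul, smul_eq_mul, Finset.mul_sum]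
      exact Finset.sum_congr rfl fun a _ => Finset.sum_congr rfl fun b _ => by ring)

/-- The symmetric part has rank one because the weights y/(x+y) and x/(x+y) sum to one. Truncating
coefficients makes this hold for all polynomials, although only finitely many powers are integrable.
-/
theorem cauchyForm_add_swap {α : ℝ → ℂ} {Q : ℂ[X]} {n : ℕ}
    (hQ : ∀ a < n, IntegrableOn (fun x : ℝ => (x : ℂ) ^ a / Q.eval (x : ℂ) * α x) (Set.Ioi 0))
    (p q : ℂ[X]) : cauchyForm α Q n p q + cauchyForm α Q n q p =
      (∑ a : Fin n, p.coeff a * ∫ x : ℝ in Set.Ioi 0, (x : ℂ) ^ (a : ℕ) / Q.eval (x : ℂ) * α x) *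
      ∑ a : Fin n, q.coeff a * ∫ x : ℝ in Set.Ioi 0, (x : ℂ) ^ (a : ℕ) / Q.eval (x : ℂ) * α x := by
  simp only [cauchyForm, LinearMap.mk₂_apply]
  rw [Finset.sum_comm (s := Finset.univ) (t := Finset.univ) (f := fun a b : Fin n =>
    q.coeff a * p.coeff b * _), ← Finset.sum_add_distrib, Finset.sum_mul_sum]
  refine Finset.sum_congr rfl fun a _ => ?_
  rw [← Finset.sum_add_distrib]
  refine Finset.sum_congr rfl fun b _ => ?_
  have h := cauchyPairing_add_swap (hQ a a.2) (hQ b b.2)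
  linear_combination (p.coeff a * q.coeff b) * h

theorem eval_div_eq_sum {p : ℂ[X]} {n : ℕ} (hp : p.natDegree < n) (Q : ℂ[X]) (x y : ℂ) :
    p.eval x / Q.eval x * y = ∑ a : Fin n, p.coeff a * (x ^ (a : ℕ) / Q.eval x * y) := by
  rw [eval_eq_sum_fin hp, Finset.sum_div, Finset.sum_mul]
  exact Finset.sum_congr rfl fun a _ => by ring

theorem integrableOn_eval_div {α : ℝ → ℂ} {Q : ℂ[X]} {n : ℕ}
    (hQ : ∀ a < n, IntegrableOn (fun x : ℝ => (x : ℂ) ^ a / Q.eval (x : ℂ) * α x) (Set.Ioi 0))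
    {p : ℂ[X]} (hp : p.natDegree < n) :
    IntegrableOn (fun x : ℝ => p.eval (x : ℂ) / Q.eval (x : ℂ) * α x) (Set.Ioi 0) := by
  simp only [eval_div_eq_sum hp]
  exact integrable_finsetSum _ fun a _ => (hQ a a.2).const_mul _

theorem cauchyForm_apply {α : ℝ → ℂ} {Q : ℂ[X]} {n : ℕ}
    (hQ : ∀ a < n, IntegrableOn (fun x : ℝ => (x : ℂ) ^ a / Q.eval (x : ℂ) * α x) (Set.Ioi 0))
    {p q : ℂ[X]} (hp : p.natDegree < n) (hq : q.natDegree < n) :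
    cauchyForm α Q n p q = cauchyPairing α (fun x => p.eval (x : ℂ) / Q.eval (x : ℂ))
      fun x => q.eval (x : ℂ) / Q.eval (x : ℂ) := by
  simp only [cauchyForm, LinearMap.mk₂_apply]
  have hint := fun a b : Fin n => integrable_cauchyPairing (hQ a a.2) (hQ b b.2)
  simp only [cauchyPairing]
  simp only [← integral_const_mul]
  rw [Finset.sum_congr rfl fun a _ =>
    (integral_finsetSum _ fun b _ => (hint a b).const_mul _).symm]
  rw [← integral_finsetSum _ fun a _ => integrable_finsetSum _ fun b _ => (hint a b).const_mul _]
  refine integral_congr_ae (Filter.Eventually.of_forall fun z => ?_)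
  simp only [eval_div_eq_sum hp, eval_div_eq_sum hq]
  rw [Finset.sum_mul_sum]
  simp only [Finset.sum_mul]
  exact Finset.sum_congr rfl fun a _ => Finset.sum_congr rfl fun b _ => by ring

/-- The degree bounds keep p X^a and q X^a, a < N, below the truncation, where the form is the
actual integral. -/
theorem cauchyPartition_eq_gramDet {α : ℝ → ℂ} {Q : ℂ[X]} {n N : ℕ}
    (hQ : ∀ a < n, IntegrableOn (fun x : ℝ => (x : ℂ) ^ a / Q.eval (x : ℂ) * α x) (Set.Ioi 0))
    {k₁ l₁ k₂ l₂ : ℕ} {kap₁ : Fin k₁ → ℂ} {lam₁ : Fin l₁ → ℂ} {kap₂ : Fin k₂ → ℂ}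
    {lam₂ : Fin l₂ → ℂ} {p q : ℂ[X]} (hp : p.natDegree + N ≤ n) (hq : q.natDegree + N ≤ n)
    (h₁ : ∀ x : ℝ, 0 < x → charRatio kap₁ lam₁ x = p.eval (x : ℂ) / Q.eval (x : ℂ))
    (h₂ : ∀ x : ℝ, 0 < x → charRatio kap₂ lam₂ x = q.eval (x : ℂ) / Q.eval (x : ℂ)) :
    cauchyPartition α N kap₁ lam₁ kap₂ lam₂ = gramDet (cauchyForm α Q n) p q N := by
  have hdeg : ∀ {r : ℂ[X]}, r.natDegree + N ≤ n → ∀ a < N, (r * X ^ a).natDegree < n := by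
    intro r hr a ha
    have := natDegree_mul_le (p := r) (q := X ^ a)
    rw [natDegree_X_pow] at this
    omega
  have heval : ∀ {k l : ℕ} {kap : Fin k → ℂ} {lam : Fin l → ℂ} {r : ℂ[X]},
      (∀ x : ℝ, 0 < x → charRatio kap lam x = r.eval (x : ℂ) / Q.eval (x : ℂ)) →
      ∀ a : ℕ, ∀ x : ℝ, 0 < x → charRatio kap lam x * (x : ℂ) ^ a =
        (r * X ^ a).eval (x : ℂ) / Q.eval (x : ℂ) := by
    intro k l kap lam r h a x hx
    rw [h x hx, eval_mul, eval_pow, eval_X]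
    ring
  have hint : ∀ {k l : ℕ} {kap : Fin k → ℂ} {lam : Fin l → ℂ} {r : ℂ[X]},
      r.natDegree + N ≤ n →
      (∀ x : ℝ, 0 < x → charRatio kap lam x = r.eval (x : ℂ) / Q.eval (x : ℂ)) →
      ∀ a < N, IntegrableOn (fun x : ℝ => charRatio kap lam x * (x : ℂ) ^ a * α x)
        (Set.Ioi 0) := by
    intro k l kap lam r hr h a ha
    refine (integrableOn_eval_div hQ (hdeg hr a ha)).congr_fun (fun x hx => ?_) measurableSet_Ioi
    simp only [heval h a x hx]
  rw [cauchyPartition_eq_det α N _ _ _ _ (hint hp h₁) (hint hq h₂), gramDet]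
  congr 1
  ext a b
  rw [of_apply, gramMatrix_apply, cauchyForm_apply hQ (hdeg hp a a.2) (hdeg hq b b.2)]
  exact cauchyPairing_congr (heval h₁ a) (heval h₂ b)

end CauchyForm

/-! ### Identification of the Schur complement entries with the kernels -/

section KernelEntries

open Matrix Polynomial

theorem charRatio_nil_nil {Q : ℂ[X]} {x : ℂ} (hQ : Q.eval x ≠ 0) (y : ℝ) :
    charRatio ![] ![] y = Q.eval x / Q.eval x := by
  simp [charRatio, hQ]

theorem charRatio_eq_of_cons {c : ℂ} {q Q r : ℂ[X]} (hq : q * (X - C c) = Q) {x : ℝ}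
    (hQ : Q.eval (x : ℂ) ≠ 0) {l : ℕ} {lam : Fin l → ℂ}
    (hr : r.eval (x : ℂ) = ∏ i, ((x : ℂ) - lam i)) :
    charRatio ![c] lam x = (q * r).eval (x : ℂ) / Q.eval (x : ℂ) := by
  have h : q.eval (x : ℂ) * ((x : ℂ) - c) = Q.eval (x : ℂ) := by simp [← hq]
  rw [← h] at hQ ⊢
  rw [eval_mul, mul_div_mul_left _ _ (left_ne_zero_of_mul hQ), hr]
  simp [charRatio]

theorem charRatio_eq_of_nil {Q r : ℂ[X]} {x : ℝ} (hQ : Q.eval (x : ℂ) ≠ 0) {l : ℕ}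
    {lam : Fin l → ℂ} (hr : r.eval (x : ℂ) = ∏ i, ((x : ℂ) - lam i)) :
    charRatio ![] lam x = (Q * r).eval (x : ℂ) / Q.eval (x : ℂ) := by
  rw [eval_mul, mul_div_cancel_left₀ _ hQ, hr]
  simp [charRatio]

/-- Evaluation at `x`, normalized to take the value one at `Q`. -/
noncomputable def normalizedEval (Q : ℂ[X]) (x : ℂ) : ℂ[X] →ₗ[ℂ] ℂ :=
  (Q.eval x)⁻¹ • leval x

theorem normalizedEval_apply (Q p : ℂ[X]) (x : ℂ) :
    normalizedEval Q x p = (Q.eval x)⁻¹ * p.eval x := rfl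

theorem normalizedEval_mul_X_sub_C (Q p q : ℂ[X]) (x : ℂ) :
    normalizedEval Q x (p * ((X - C x) * q)) = 0 := by
  simp [normalizedEval_apply]

theorem normalizedEval_self {Q : ℂ[X]} {x : ℂ} (hQ : Q.eval x ≠ 0) :
    normalizedEval Q x Q = 1 := by
  rw [normalizedEval_apply, inv_mul_cancel₀ hQ]

theorem normalizedEval_of_mul {c x : ℂ} {q Q : ℂ[X]} (hq : q * (X - C c) = Q)
    (hQ : Q.eval x ≠ 0) : normalizedEval Q x q = (x - c)⁻¹ := by
  have h : q.eval x * (x - c) = Q.eval x := by simp [← hq]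
  rw [← h] at hQ
  have h1 := left_ne_zero_of_mul hQ
  have h2 := right_ne_zero_of_mul hQ
  rw [normalizedEval_apply, ← h]
  field_simp

variable {J : Type*} [Fintype J] [DecidableEq J] {α : ℝ → ℂ} {Q : ℂ[X]} {k L : ℕ}

theorem cauchyNormalization_eq
    (hQ : ∀ a < k + L, IntegrableOn (fun x : ℝ => (x : ℂ) ^ a / Q.eval (x : ℂ) * α x) (Set.Ioi 0))
    (hQdeg : Q.natDegree = k) (hQ0 : ∀ x : ℝ, 0 < x → Q.eval (x : ℂ) ≠ 0) :
    cauchyNormalization α L = gramDet (cauchyForm α Q (k + L)) Q Q L :=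
  cauchyPartition_eq_gramDet hQ (by omega) (by omega)
    (fun x hx => charRatio_nil_nil (hQ0 x hx) x) fun x hx => charRatio_nil_nil (hQ0 x hx) x

omit [DecidableEq J] in
theorem borderDet_sub_eq_kernel11
    (hQ : ∀ a < k + L, IntegrableOn (fun x : ℝ => (x : ℂ) ^ a / Q.eval (x : ℂ) * α x) (Set.Ioi 0))
    (hQdeg : Q.natDegree = k) (hQ0 : ∀ x : ℝ, 0 < x → Q.eval (x : ℂ) ≠ 0)
    (φ : J → ℂ[X] →ₗ[ℂ] ℂ) {c c' : ℂ} {q q' : ℂ[X]} (hq : q * (X - C c) = Q)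
    (hq' : q' * (X - C c') = Q) (hqdeg : q.natDegree + 1 = k) (hqdeg' : q'.natDegree + 1 = k) :
    (borderDet (cauchyForm α Q (k + L)) φ Q L (q, 0) (q', 0) -
      borderDet (cauchyForm α Q (k + L)) φ Q L (q', 0) (q, 0)) /
      (2 * gramDet (cauchyForm α Q (k + L)) Q Q L) = kernel11 α (L + 1) c c' := by
  have hr : ∀ {c : ℂ} {q : ℂ[X]}, q * (X - C c) = Q → ∀ x : ℝ, 0 < x →
      charRatio ![c] ![] x = q.eval (x : ℂ) / Q.eval (x : ℂ) := by
    intro c q hq x hx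
    have := charRatio_eq_of_cons (r := 1) (lam := ![]) hq (hQ0 x hx) (by simp)
    rwa [mul_one] at this
  rw [borderDet_inl_inl _ φ hq hq', borderDet_inl_inl _ φ hq' hq, kernel11, Nat.add_sub_cancel,
    cauchyNormalization_eq hQ hQdeg hQ0,
    cauchyPartition_eq_gramDet hQ (by omega) (by omega) (hr hq) (hr hq'),
    cauchyPartition_eq_gramDet hQ (by omega) (by omega) (hr hq') (hr hq)]

/-- Functionals pair antisymmetrically with polynomials, so the difference of the two orders becomes
a sum of partition functions. The normalized evaluation of q = Q/(X - c) at y is 1/(y - c), which is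
the factor -1/(κ - λ). -/
theorem borderDet_sub_eq_kernel01
    (hQ : ∀ a < k + L, IntegrableOn (fun x : ℝ => (x : ℂ) ^ a / Q.eval (x : ℂ) * α x) (Set.Ioi 0))
    (hQdeg : Q.natDegree = k) (hQ0 : ∀ x : ℝ, 0 < x → Q.eval (x : ℂ) ≠ 0)
    (φ : J → ℂ[X] →ₗ[ℂ] ℂ) {c y : ℂ} {q : ℂ[X]} (hq : q * (X - C c) = Q)
    (hqdeg : q.natDegree + 1 = k) (hy : Q.eval y ≠ 0) {j : J} (hφ : φ j = normalizedEval Q y) :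
    (borderDet (cauchyForm α Q (k + L)) φ Q L (q, 0) (functionalVector j) -
      borderDet (cauchyForm α Q (k + L)) φ Q L (functionalVector j) (q, 0)) /
      (2 * gramDet (cauchyForm α Q (k + L)) Q Q L) = -kernel01 α L c y := by
  have hr : ∀ x : ℝ, 0 < x →
      charRatio ![c] ![y] x = (q * (X - C y)).eval (x : ℂ) / Q.eval (x : ℂ) := fun x hx =>
    charRatio_eq_of_cons hq (hQ0 x hx) (by simp)
  have hdeg : (q * (X - C y)).natDegree ≤ k := by
    refine natDegree_mul_le.trans ?_
    rw [natDegree_X_sub_C, hqdeg]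
  rw [borderDet_inl_functional, borderDet_functional_inl,
    functionalDet_eval _ _ hq L y fun a => by rw [hφ, normalizedEval_mul_X_sub_C],
    functionalDet_eval _ _ hq L y fun a => by
      rw [LinearMap.neg_apply, hφ, normalizedEval_mul_X_sub_C, neg_zero],
    LinearMap.neg_apply, hφ, normalizedEval_of_mul hq hy, gramDet_flip, kernel01,
    cauchyNormalization_eq hQ hQdeg hQ0,
    cauchyPartition_eq_gramDet hQ (by omega) (by omega)
      (fun x hx => charRatio_nil_nil (hQ0 x hx) x) hr,
    cauchyPartition_eq_gramDet hQ (by omega) (by omega) hr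
      fun x hx => charRatio_nil_nil (hQ0 x hx) x, ← neg_sub c y, inv_neg, div_eq_mul_inv,
    div_eq_mul_inv, mul_inv, mul_inv, mul_inv]
  ring

/-- Row and column expansion each remove one polynomial index and attach a factor X - λ to the other
variable; hence the size L against normalization L + 1 and the interchanged points. -/
theorem borderDet_sub_eq_kernel00
    (hQ : ∀ a < k + (L + 1),
      IntegrableOn (fun x : ℝ => (x : ℂ) ^ a / Q.eval (x : ℂ) * α x) (Set.Ioi 0))
    (hQdeg : Q.natDegree = k) (hQ0 : ∀ x : ℝ, 0 < x → Q.eval (x : ℂ) ≠ 0)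
    (φ : J → ℂ[X] →ₗ[ℂ] ℂ) {y z : ℂ} (hy : Q.eval y ≠ 0) (hz : Q.eval z ≠ 0) {i j : J}
    (hi : φ i = normalizedEval Q y) (hj : φ j = normalizedEval Q z) :
    (borderDet (cauchyForm α Q (k + (L + 1))) φ Q (L + 1) (functionalVector i)
        (functionalVector j) -
      borderDet (cauchyForm α Q (k + (L + 1))) φ Q (L + 1) (functionalVector j)
        (functionalVector i)) /
      (2 * gramDet (cauchyForm α Q (k + (L + 1))) Q Q (L + 1)) = kernel00 α L y z := by
  have hr : ∀ y : ℂ, ∀ x : ℝ, 0 < x →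
      charRatio ![] ![y] x = (Q * (X - C y)).eval (x : ℂ) / Q.eval (x : ℂ) := fun y x hx =>
    charRatio_eq_of_nil (hQ0 x hx) (by simp)
  have hdeg : ∀ y : ℂ, (Q * (X - C y)).natDegree + L ≤ k + (L + 1) := by
    intro y
    have := natDegree_mul_le (p := Q) (q := X - C y)
    rw [natDegree_X_sub_C, hQdeg] at this
    omega
  rw [borderDet_functional_functional, borderDet_functional_functional,
    functionalPairDet_eval_eval _ _ _ Q L y z
      (fun a => by rw [LinearMap.neg_apply, hi, normalizedEval_mul_X_sub_C, neg_zero])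
      (fun a => by rw [hj, normalizedEval_mul_X_sub_C]),
    functionalPairDet_eval_eval _ _ _ Q L z y
      (fun a => by rw [LinearMap.neg_apply, hj, normalizedEval_mul_X_sub_C, neg_zero])
      (fun a => by rw [hi, normalizedEval_mul_X_sub_C]),
    LinearMap.neg_apply, LinearMap.neg_apply, hi, hj, normalizedEval_self hy,
    normalizedEval_self hz, kernel00, cauchyNormalization_eq hQ hQdeg hQ0,
    cauchyPartition_eq_gramDet hQ (hdeg _) (hdeg _) (hr z) (hr y),
    cauchyPartition_eq_gramDet hQ (hdeg _) (hdeg _) (hr y) (hr z)]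
  simp

/-- The coefficient of degree `k + L`, with the sign `(-1) ^ L`. -/
noncomputable def signedCoeff (k L : ℕ) : ℂ[X] →ₗ[ℂ] ℂ := (-1 : ℂ) ^ L • lcoeff ℂ (k + L)

theorem signedCoeff_apply (k L : ℕ) (p : ℂ[X]) :
    signedCoeff k L p = (-1) ^ L * p.coeff (k + L) := rfl

theorem signedCoeff_eq_zero {p : ℂ[X]} (hp : p.natDegree < k + L) : signedCoeff k L p = 0 := by
  rw [signedCoeff_apply, coeff_eq_zero_of_natDegree_lt hp, mul_zero]

theorem signedCoeff_of_monic {p : ℂ[X]} (hp : p.Monic) (hdeg : p.natDegree = k + L) :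
    signedCoeff k L p = (-1) ^ L := by
  rw [signedCoeff_apply, ← hdeg, hp.coeff_natDegree, mul_one]

theorem natDegree_mul_X_pow_lt {p : ℂ[X]} {n a : ℕ} (h : p.natDegree + a < n) :
    (p * X ^ a).natDegree < n := by
  refine natDegree_mul_le.trans_lt ?_
  rwa [natDegree_X_pow]

theorem borderDet_sub_eq_kernel1
    (hQ : ∀ a < k + (L + 1),
      IntegrableOn (fun x : ℝ => (x : ℂ) ^ a / Q.eval (x : ℂ) * α x) (Set.Ioi 0))
    (hQdeg : Q.natDegree = k) (hQ0 : ∀ x : ℝ, 0 < x → Q.eval (x : ℂ) ≠ 0)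
    (φ : J → ℂ[X] →ₗ[ℂ] ℂ) {c : ℂ} {q : ℂ[X]} (hq : q * (X - C c) = Q) (hqm : q.Monic)
    (hqdeg : q.natDegree + 1 = k) {j : J} (hφ : φ j = signedCoeff k L) :
    (borderDet (cauchyForm α Q (k + (L + 1))) φ Q (L + 1) (q, 0) (functionalVector j) -
      borderDet (cauchyForm α Q (k + (L + 1))) φ Q (L + 1) (functionalVector j) (q, 0)) /
      (2 * gramDet (cauchyForm α Q (k + (L + 1))) Q Q (L + 1)) = -kernel1 α (L + 1) c := by
  have hr : ∀ x : ℝ, 0 < x →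
      charRatio ![c] ![] x = q.eval (x : ℂ) / Q.eval (x : ℂ) := by
    intro x hx
    have := charRatio_eq_of_cons (r := 1) (lam := ![]) hq (hQ0 x hx) (by simp)
    rwa [mul_one] at this
  have hzero : ∀ a : Fin (L + 1), signedCoeff k L (q * X ^ (a : ℕ)) = 0 := fun a =>
    signedCoeff_eq_zero (natDegree_mul_X_pow_lt (by have := a.2; omega))
  have hlead : signedCoeff k L (q * X ^ (L + 1)) = (-1) ^ L := by
    refine signedCoeff_of_monic (hqm.mul (monic_X_pow _)) ?_
    rw [hqm.natDegree_mul (monic_X_pow _), natDegree_X_pow]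
    omega
  -- The cofactor sign (-1)^(L+1) meets the sign built into `signedCoeff`, so the entry does not
  -- depend on the parity of L.
  have hsign : (-1 : ℂ) ^ (L + 1) * (-1) ^ L = -1 := by
    rw [← pow_add, (by ring : L + 1 + L = 2 * L + 1)]
    simp [pow_succ, pow_mul]
  rw [borderDet_inl_functional, borderDet_functional_inl,
    functionalDet_coeff _ _ hq (L + 1) fun a => by rw [hφ, hzero],
    functionalDet_coeff _ _ hq (L + 1) fun a => by
      rw [LinearMap.neg_apply, hφ, hzero, neg_zero],
    LinearMap.neg_apply, hφ, hlead, mul_neg, hsign, gramDet_flip, kernel1,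
    cauchyNormalization_eq hQ hQdeg hQ0,
    cauchyPartition_eq_gramDet hQ (by omega) (by omega)
      (fun x hx => charRatio_nil_nil (hQ0 x hx) x) hr,
    cauchyPartition_eq_gramDet hQ (by omega) (by omega) hr
      fun x hx => charRatio_nil_nil (hQ0 x hx) x]
  ring

theorem borderDet_sub_eq_kernel0
    (hQ : ∀ a < k + (L + 1),
      IntegrableOn (fun x : ℝ => (x : ℂ) ^ a / Q.eval (x : ℂ) * α x) (Set.Ioi 0))
    (hQm : Q.Monic) (hQdeg : Q.natDegree = k) (hQ0 : ∀ x : ℝ, 0 < x → Q.eval (x : ℂ) ≠ 0)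
    (φ : J → ℂ[X] →ₗ[ℂ] ℂ) {y : ℂ} (hy : Q.eval y ≠ 0) {i j : J}
    (hi : φ i = normalizedEval Q y) (hj : φ j = signedCoeff k L) :
    (borderDet (cauchyForm α Q (k + (L + 1))) φ Q (L + 1) (functionalVector i)
        (functionalVector j) -
      borderDet (cauchyForm α Q (k + (L + 1))) φ Q (L + 1) (functionalVector j)
        (functionalVector i)) /
      (2 * gramDet (cauchyForm α Q (k + (L + 1))) Q Q (L + 1)) = kernel0 α L y := by
  have hr : ∀ x : ℝ, 0 < x →
      charRatio ![] ![y] x = (Q * (X - C y)).eval (x : ℂ) / Q.eval (x : ℂ) := fun x hx =>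
    charRatio_eq_of_nil (hQ0 x hx) (by simp)
  have hdeg : (Q * (X - C y)).natDegree + L ≤ k + (L + 1) := by
    have := natDegree_mul_le (p := Q) (q := X - C y)
    rw [natDegree_X_sub_C, hQdeg] at this
    omega
  have hzero : ∀ a : Fin L, signedCoeff k L (Q * X ^ (a : ℕ)) = 0 := fun a =>
    signedCoeff_eq_zero (natDegree_mul_X_pow_lt (by have := a.2; omega))
  have hlead : signedCoeff k L (Q * X ^ L) = (-1) ^ L := by
    refine signedCoeff_of_monic (hQm.mul (monic_X_pow _)) ?_
    rw [hQm.natDegree_mul (monic_X_pow _), natDegree_X_pow, hQdeg]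
  have hsign : (-1 : ℂ) ^ L * (-1) ^ L = 1 := by
    rw [← mul_pow]
    simp
  -- One of the two orders is transposed so that the evaluation functional occupies the row border
  -- in both.
  rw [borderDet_functional_functional, borderDet_functional_functional,
    ← functionalPairDet_flip _ (-φ j),
    functionalPairDet_eval_coeff _ _ _ Q L y
      (fun a => by rw [LinearMap.neg_apply, hi, normalizedEval_mul_X_sub_C, neg_zero])
      (fun a => by rw [hj, hzero]),
    functionalPairDet_eval_coeff _ _ _ Q L y
      (fun a => by rw [hi, normalizedEval_mul_X_sub_C])
      (fun a => by rw [LinearMap.neg_apply, hj, hzero, neg_zero]),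
    LinearMap.neg_apply, LinearMap.neg_apply, hi, hj, normalizedEval_self hy, hlead, mul_neg,
    hsign, gramDet_flip, kernel0, cauchyNormalization_eq hQ hQdeg hQ0,
    cauchyPartition_eq_gramDet hQ (by omega) hdeg
      (fun x hx => charRatio_nil_nil (hQ0 x hx) x) hr,
    cauchyPartition_eq_gramDet hQ hdeg (by omega) hr
      fun x hx => charRatio_nil_nil (hQ0 x hx) x]
  ring

omit [DecidableEq J] in
theorem borderDet_self_sub (β : ℂ[X] →ₗ[ℂ] ℂ[X] →ₗ[ℂ] ℂ) (φ : J → ℂ[X] →ₗ[ℂ] ℂ)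
    (x y : ℂ[X] × (J → ℂ)) {z v : ℂ}
    (h : (borderDet β φ Q L x y - borderDet β φ Q L y x) / z = v) :
    (borderDet β φ Q L y x - borderDet β φ Q L x y) / z = -v := by
  rw [← h, ← neg_div, neg_sub]

end KernelEntries

/-! ### The even and odd cases -/

section Main

open Matrix Polynomial

variable {k l : ℕ} {kap : Fin k → ℂ} {lam : Fin l → ℂ}

theorem monic_nodal (u : Fin k → ℂ) : (∏ i, (X - C (u i)) : ℂ[X]).Monic :=
  monic_prod_of_monic _ _ fun i _ => monic_X_sub_C (u i)

theorem natDegree_nodal (u : Fin k → ℂ) : (∏ i, (X - C (u i)) : ℂ[X]).natDegree = k := by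
  rw [natDegree_prod_of_monic _ _ fun i _ => monic_X_sub_C (u i)]
  simp

theorem natDegree_lagrangeNumerator_add_one (u : Fin k → ℂ) (i : Fin k) :
    (lagrangeNumerator u i).natDegree + 1 = k := by
  have := i.pos
  rw [natDegree_lagrangeNumerator]
  omega

theorem eval_nodal_ne_zero {u : Fin k → ℂ} {x : ℂ} (h : ∀ i, u i ≠ x) :
    (∏ i, (X - C (u i)) : ℂ[X]).eval x ≠ 0 := by
  rw [eval_prod_X_sub_C]
  exact Finset.prod_ne_zero_iff.2 fun i _ => sub_ne_zero.2 (h i).symm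

theorem charRatio_eq_eval_div (kap : Fin k → ℂ) (lam : Fin l → ℂ) (x : ℝ) :
    charRatio kap lam x =
      (∏ i, (X - C (lam i)) : ℂ[X]).eval (x : ℂ) / (∏ i, (X - C (kap i)) : ℂ[X]).eval (x : ℂ) := by
  rw [eval_prod_X_sub_C, eval_prod_X_sub_C, charRatio]

/-- Normalizing by 1/Q(λ_j) supplies the cross product in B; squaring removes the signs of λ_j -
κ_i. -/
theorem det_normalizedEval_sq_mul (kap : Fin k → ℂ) (lam : Fin l → ℂ) :
    (of fun i j : Fin l => normalizedEval (∏ i, (X - C (kap i))) (lam j) (X ^ (i : ℕ))).det ^ 2 *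
      vandermondeProd kap ^ 2 = mixedCauchyVandermonde kap lam ^ 2 := by
  have h : (of fun i j : Fin l =>
      normalizedEval (∏ i, (X - C (kap i))) (lam j) (X ^ (i : ℕ))).det =
      (∏ j, ((∏ i, (X - C (kap i)) : ℂ[X]).eval (lam j))⁻¹) * vandermondeProd lam := by
    rw [vandermondeProd_eq_det, ← det_transpose (vandermonde lam), ← det_mul_row]
    congr 1
    ext i j
    simp [normalizedEval_apply]
  have hsq : (∏ j, (∏ i, (X - C (kap i)) : ℂ[X]).eval (lam j)) ^ 2 =
      (∏ i, ∏ j, (kap i - lam j)) ^ 2 := by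
    rw [Finset.prod_comm]
    simp only [eval_prod_X_sub_C, ← Finset.prod_pow]
    refine Finset.prod_congr rfl fun j _ => Finset.prod_congr rfl fun i _ => ?_
    ring
  rw [h, mixedCauchyVandermonde, Finset.prod_inv_distrib, mul_pow, inv_pow, hsq, div_pow, mul_pow,
    div_eq_mul_inv]
  ring

theorem mixedCauchyVandermonde_ne_zero (hkap : Function.Injective kap)
    (hlam : Function.Injective lam) (hdisj : ∀ i j, kap i ≠ lam j) :
    mixedCauchyVandermonde kap lam ≠ 0 :=
  div_ne_zero (mul_ne_zero (vandermondeProd_ne_zero hkap) (vandermondeProd_ne_zero hlam))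
    (Finset.prod_ne_zero_iff.2 fun i _ => Finset.prod_ne_zero_iff.2 fun j _ =>
      sub_ne_zero.2 (hdisj i j))

theorem cauchyPartition_eq_det_even {N L : ℕ} (hN : N + l = k + (L + 1)) {α : ℝ → ℂ}
    (hkap : ∀ i, ∀ t : ℝ, 0 ≤ t → kap i ≠ (t : ℂ)) (hkap_inj : Function.Injective kap)
    (hlam_inj : Function.Injective lam) (hdisj : ∀ i j, kap i ≠ lam j) (heven : Even (k + l))
    (hα : ∀ n < L + 1, IntegrableOn (fun x : ℝ => (x : ℂ) ^ n * α x) (Set.Ioi 0))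
    (hZ : cauchyNormalization α (L + 1) ≠ 0) :
    cauchyPartition α N kap lam kap lam =
      cauchyNormalization α (L + 1) / mixedCauchyVandermonde kap lam ^ 2 *
        (kernelMatrixEven α (L + 1) kap lam).det := by
  set Q : ℂ[X] := ∏ i, (X - C (kap i)) with hQdef
  have hQ : ∀ a < k + (L + 1),
      IntegrableOn (fun x : ℝ => (x : ℂ) ^ a / Q.eval (x : ℂ) * α x) (Set.Ioi 0) := fun a ha =>
    integrableOn_pow_div hkap L.succ_pos hα ha
  have hQdeg : Q.natDegree = k := natDegree_nodal kap
  have hQ0 : ∀ x : ℝ, 0 < x → Q.eval (x : ℂ) ≠ 0 := fun x hx =>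
    eval_nodal_ne_zero fun i => hkap i x hx.le
  have hQlam : ∀ j, Q.eval (lam j) ≠ 0 := fun j => eval_nodal_ne_zero fun i => hdisj i j
  have hB := mixedCauchyVandermonde_ne_zero hkap_inj hlam_inj hdisj
  have hnorm := cauchyNormalization_eq hQ hQdeg hQ0
  let φ : Fin l → ℂ[X] →ₗ[ℂ] ℂ := fun j => normalizedEval Q (lam j)
  have hlamdeg := natDegree_nodal lam
  -- Matching by degree: X^j with j < l comes first, then P X^a of degree l + a.
  let e : Fin N ⊕ Fin l ≃ Fin (k + (L + 1)) :=
    ((Equiv.sumComm (Fin N) (Fin l)).trans finSumFinEquiv).trans (finCongr (by omega))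
  have main := gramDet_mul_eq_det_borderDet (β := cauchyForm α Q (k + (L + 1)))
    (cauchyForm_add_swap hQ) φ hkap_inj rfl (monic_nodal lam) (c := fun j => X ^ (j : ℕ))
    (fun j => monic_X_pow _)
    e (fun a => by simp [hlamdeg, e]) (fun j => by simp [e])
    (fun j a => by
      rw [← Finset.mul_prod_erase _ _ (Finset.mem_univ j), mul_assoc]
      have := normalizedEval_mul_X_sub_C Q 1
        ((∏ i ∈ Finset.univ.erase j, (X - C (lam i))) * X ^ (a : ℕ)) (lam j)
      rwa [one_mul] at this)
    (by rwa [← hnorm]) (by simpa using heven)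
  rw [mul_assoc, det_normalizedEval_sq_mul, ← cauchyPartition_eq_gramDet hQ
    (by omega) (by omega) (fun x _ => charRatio_eq_eval_div kap lam x)
    (fun x _ => charRatio_eq_eval_div kap lam x)] at main
  rw [div_mul_eq_mul_div, eq_div_iff (pow_ne_zero 2 hB), main, hnorm]
  congr 2
  have h01 : ∀ i j, _ := fun i j => borderDet_sub_eq_kernel01 hQ hQdeg hQ0 φ
    (lagrangeNumerator_mul kap i) (natDegree_lagrangeNumerator_add_one kap i) (hQlam j) (j := j) rfl
  ext s t
  rcases s with i | i <;> rcases t with j | j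
  · exact borderDet_sub_eq_kernel11 hQ hQdeg hQ0 φ (lagrangeNumerator_mul kap i)
      (lagrangeNumerator_mul kap j) (natDegree_lagrangeNumerator_add_one kap i)
      (natDegree_lagrangeNumerator_add_one kap j)
  · exact h01 i j
  · exact (borderDet_self_sub _ _ _ _ (h01 j i)).trans (neg_neg _)
  · exact borderDet_sub_eq_kernel00 hQ hQdeg hQ0 φ (hQlam i) (hQlam j) rfl rfl

theorem det_fromBlocks_one_corner (V : Matrix (Fin l) (Fin l) ℂ) (r : Fin l → ℂ) (c : ℂ) :
    (of fun s t : Fin l ⊕ Unit => Sum.elim (fun i => Sum.elim (fun j => V i j) (fun _ => 0) t)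
      (fun _ => Sum.elim r (fun _ => c) t) s).det = V.det * c := by
  rw [show (of fun s t : Fin l ⊕ Unit =>
      Sum.elim (fun i => Sum.elim (fun j => V i j) (fun _ => 0) t)
      (fun _ => Sum.elim r (fun _ => c) t) s) =
      fromBlocks V 0 (of fun _ j => r j) (of fun _ _ => c) by
    ext s t
    rcases s with s | s <;> rcases t with t | t <;> rfl, det_fromBlocks_zero₁₂]
  simp

/-- For odd k + l the top coefficient is adjoined as one more functional and X^(k+L) as one more
monomial, which makes the Schur complement of even size. Since k + L = N + l, this functional kills
every P X^a; it produces the last row and column. -/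
theorem cauchyPartition_eq_det_odd {N L : ℕ} (hN : N + l = k + L) {α : ℝ → ℂ}
    (hkap : ∀ i, ∀ t : ℝ, 0 ≤ t → kap i ≠ (t : ℂ)) (hkap_inj : Function.Injective kap)
    (hlam_inj : Function.Injective lam) (hdisj : ∀ i j, kap i ≠ lam j) (hodd : Odd (k + l))
    (hα : ∀ n < L + 1, IntegrableOn (fun x : ℝ => (x : ℂ) ^ n * α x) (Set.Ioi 0))
    (hZ : cauchyNormalization α (L + 1) ≠ 0) :
    cauchyPartition α N kap lam kap lam =
      cauchyNormalization α (L + 1) / mixedCauchyVandermonde kap lam ^ 2 *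
        (kernelMatrixOdd α (L + 1) kap lam).det := by
  set Q : ℂ[X] := ∏ i, (X - C (kap i)) with hQdef
  have hQ : ∀ a < k + (L + 1),
      IntegrableOn (fun x : ℝ => (x : ℂ) ^ a / Q.eval (x : ℂ) * α x) (Set.Ioi 0) := fun a ha =>
    integrableOn_pow_div hkap L.succ_pos hα ha
  have hQdeg : Q.natDegree = k := natDegree_nodal kap
  have hQm : Q.Monic := monic_nodal kap
  have hQ0 : ∀ x : ℝ, 0 < x → Q.eval (x : ℂ) ≠ 0 := fun x hx =>
    eval_nodal_ne_zero fun i => hkap i x hx.le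
  have hQlam : ∀ j, Q.eval (lam j) ≠ 0 := fun j => eval_nodal_ne_zero fun i => hdisj i j
  have hB := mixedCauchyVandermonde_ne_zero hkap_inj hlam_inj hdisj
  have hnorm := cauchyNormalization_eq hQ hQdeg hQ0
  let φ : Fin l ⊕ Unit → ℂ[X] →ₗ[ℂ] ℂ :=
    Sum.elim (fun j => normalizedEval Q (lam j)) fun _ => signedCoeff k L
  have hlamdeg := natDegree_nodal lam
  let e : Fin N ⊕ (Fin l ⊕ Unit) ≃ Fin (k + (L + 1)) :=
    (((Equiv.sumAssoc (Fin N) (Fin l) Unit).symm.trans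
      (((Equiv.sumComm (Fin N) (Fin l)).trans finSumFinEquiv).sumCongr finOneEquiv.symm)).trans
        finSumFinEquiv).trans (finCongr (by omega))
  have main := gramDet_mul_eq_det_borderDet (β := cauchyForm α Q (k + (L + 1)))
    (cauchyForm_add_swap hQ) φ hkap_inj rfl (monic_nodal lam)
    (c := Sum.elim (fun j => X ^ (j : ℕ)) fun _ => X ^ (k + L))
    (by rintro (j | j) <;> exact monic_X_pow _) e
    (fun a => by simp [hlamdeg, e])
    (by rintro (j | j)
        · simp [e]
        · simp [e, ← hN, add_comm])
    (by rintro (j | j) a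
        · rw [← Finset.mul_prod_erase _ _ (Finset.mem_univ j), mul_assoc]
          have := normalizedEval_mul_X_sub_C Q 1
            ((∏ i ∈ Finset.univ.erase j, (X - C (lam i))) * X ^ (a : ℕ)) (lam j)
          rwa [one_mul] at this
        · exact signedCoeff_eq_zero
            (natDegree_mul_X_pow_lt (by have := a.2; omega)))
    (by rwa [← hnorm])
    (by rw [Fintype.card_sum, Fintype.card_fin, Fintype.card_unit, ← add_assoc]
        exact hodd.add_one)
  -- The top coefficient vanishes on X^j for j < l, so the matrix is block triangular with corner
  -- (-1)^L, which disappears on squaring.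
  have hT : (of fun s t => φ t (Sum.elim (fun j : Fin l => (X : ℂ[X]) ^ (j : ℕ))
      (fun _ : Unit => X ^ (k + L)) s)).det ^ 2 =
      (of fun i j : Fin l => normalizedEval Q (lam j) (X ^ (i : ℕ))).det ^ 2 := by
    rw [show (of fun s t => φ t (Sum.elim (fun j : Fin l => (X : ℂ[X]) ^ (j : ℕ))
        (fun _ : Unit => X ^ (k + L)) s)) = of fun s t : Fin l ⊕ Unit =>
        Sum.elim (fun i => Sum.elim
          (fun j => (of fun i j : Fin l => normalizedEval Q (lam j) (X ^ (i : ℕ))) i j)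
          (fun _ => 0) t)
        (fun _ => Sum.elim (fun j => normalizedEval Q (lam j) (X ^ (k + L)))
          (fun _ => (-1) ^ L) t) s by
      ext s t
      rcases s with s | s <;> rcases t with t | t
      · rfl
      · refine signedCoeff_eq_zero ?_
        rw [Sum.elim_inl, natDegree_X_pow]
        have := s.2
        omega
      · rfl
      · exact signedCoeff_of_monic (monic_X_pow _) (natDegree_X_pow _),
      det_fromBlocks_one_corner, mul_pow, ← pow_mul, mul_comm L 2, pow_mul]
    simp
  rw [mul_assoc, hT, det_normalizedEval_sq_mul, ← cauchyPartition_eq_gramDet hQ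
    (by omega) (by omega) (fun x _ => charRatio_eq_eval_div kap lam x)
    (fun x _ => charRatio_eq_eval_div kap lam x)] at main
  rw [div_mul_eq_mul_div, eq_div_iff (pow_ne_zero 2 hB), main, hnorm,
    ← det_submatrix_equiv_self (Equiv.sumAssoc (Fin k) (Fin l) Unit)]
  congr 2
  have h01 : ∀ i j, _ := fun i j => borderDet_sub_eq_kernel01 hQ hQdeg hQ0 φ
    (lagrangeNumerator_mul kap i) (natDegree_lagrangeNumerator_add_one kap i) (hQlam j)
    (j := Sum.inl j) rfl
  have h1 : ∀ i, _ := fun i => borderDet_sub_eq_kernel1 hQ hQdeg hQ0 φ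
    (lagrangeNumerator_mul kap i) (lagrangeNumerator_monic kap i)
    (natDegree_lagrangeNumerator_add_one kap i) (j := Sum.inr ()) rfl
  have h0 : ∀ j, _ := fun j => borderDet_sub_eq_kernel0 hQ hQm hQdeg hQ0 φ (hQlam j)
    (i := Sum.inl j) (j := Sum.inr ()) rfl rfl
  ext s t
  rcases s with (i | i) | ⟨⟩ <;> rcases t with (j | j) | ⟨⟩
  · exact borderDet_sub_eq_kernel11 hQ hQdeg hQ0 φ (lagrangeNumerator_mul kap i)
      (lagrangeNumerator_mul kap j) (natDegree_lagrangeNumerator_add_one kap i)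
      (natDegree_lagrangeNumerator_add_one kap j)
  · exact h01 i j
  · exact h1 i
  · exact (borderDet_self_sub _ _ _ _ (h01 j i)).trans (neg_neg _)
  · exact borderDet_sub_eq_kernel00 hQ hQdeg hQ0 φ (hQlam i) (hQlam j) rfl rfl
  · exact h0 i
  · exact (borderDet_self_sub _ _ _ _ (h1 j)).trans (neg_neg _)
  · exact borderDet_self_sub _ _ _ _ (h0 j)
  · rw [submatrix_apply, of_apply, sub_self, zero_div]
    rfl

end Main

theorem mainTheorem2 (N k l : ℕ) (hN : k + 1 < N + l) (α : ℝ → ℂ)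
    (kap : Fin k → ℂ) (lam : Fin l → ℂ)
    (hkap : ∀ i, ∀ t : ℝ, 0 ≤ t → kap i ≠ (t : ℂ))
    (hkap_inj : Function.Injective kap) (hlam_inj : Function.Injective lam)
    (hdisj : ∀ i j, kap i ≠ lam j) :
    (Even (k + l) →
      (∀ n < N + l - k, IntegrableOn (fun x : ℝ => (x : ℂ) ^ n * α x) (Set.Ioi 0)) →
      cauchyNormalization α (N + l - k) ≠ 0 →
      cauchyPartition α N kap lam kap lam =
        cauchyNormalization α (N + l - k) / mixedCauchyVandermonde kap lam ^ 2 *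
          (kernelMatrixEven α (N + l - k) kap lam).det) ∧
    (Odd (k + l) →
      (∀ n < N + l - k + 1, IntegrableOn (fun x : ℝ => (x : ℂ) ^ n * α x) (Set.Ioi 0)) →
      cauchyNormalization α (N + l - k + 1) ≠ 0 →
      cauchyPartition α N kap lam kap lam =
        cauchyNormalization α (N + l - k + 1) / mixedCauchyVandermonde kap lam ^ 2 *
          (kernelMatrixOdd α (N + l - k + 1) kap lam).det) := by
  constructor
  -- Positivity of N + l - k makes the truncated subtraction exact and the kernel index L - 1 a true
  -- predecessor.
  · obtain ⟨L, hL⟩ : ∃ L, N + l - k = L + 1 := ⟨N + l - k - 1, by omega⟩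
    rw [hL]
    exact fun heven hα hZ => cauchyPartition_eq_det_even (by omega) hkap hkap_inj hlam_inj hdisj
      heven hα hZ
  · exact fun hodd hα hZ => cauchyPartition_eq_det_odd (by omega) hkap hkap_inj hlam_inj hdisj
      hodd hα hZ
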